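/- Let $\eta>0$ and $x_*=-2(1-e^{-\eta})/\eta$. For $\Im\tau>0$ let $$\vartheta(z|\tau)=\sum_{n\in\mathbb Z}e^{2\pi i n z+i\pi n^2\tau},\qquad \vartheta_{11}(z|\tau)=i\,e^{i\pi(z+\tau/4)}\,\vartheta\bigl(z+\tfrac{1+\tau}{2}\big|\tau\bigr),$$ and let $\vartheta_{11}'$ be the derivative of $\vartheta_{11}$ in $z$. For $K>0$ let $\Lambda=2K\mathbb Z+2\pi i\mathbb Z$ and $$\zeta(z)=\frac1z+\sum_{l\in\Lambda\setminus\{0\}}\Bigl(\frac1{z-l}+\frac1l+\frac z{l^2}\Bigr),\qquad \wp(z)=\frac1{z^2}+\sum_{l\in\Lambda\setminus\{0\}}\Bigl(\frac1{(z-l)^2}-\frac1{l^2}\Bigr)$$ be the Weierstrass functions with half-periods $K$ and $i\pi$. Define $$\mathcal U(K)=2K\,e^{\frac\eta2\left(\frac{\eta}{2K}-1\right)}\,\frac{\vartheta_{11}\bigl(\frac{\eta}{2K}\big|\frac{i\pi}{K}\bigr)}{\vartheta_{11}'\bigl(0\big|\frac{i\pi}{K}\bigr)}\quad(K\ge\eta/2),$$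 $$\mathcal V(K)=1+K\Bigl(\Bigl(\zeta(\eta)-\eta\,\frac{\zeta(i\pi)}{i\pi}\Bigr)^2-\wp(\eta)+2\,\frac{\zeta(i\pi)}{i\pi}\Bigr)\quad(K>\eta/2).$$ Then: 1. $\mathcal U(K)$ and $\mathcal V(K)$ are real for $K>\eta/2$. 2. The function $K\mapsto\mathcal U(K)\mathcal V(K)$ is strictly increasing on $(\eta/2,\infty)$; it tends to $-\eta$ as $K\downarrow\eta/2$ and to $1-e^{-\eta}$ as $K\to+\infty$. 3. $\mathcal U$ is strictly increasing on $[\eta/2,\infty)$, and $\mathcal V$ is strictly increasing on $(\eta/2,\infty)$. 4. $\mathcal U$ is differentiable on $(\eta/2,\infty)$, and $\bigl(1-K\frac{\partial}{\partial K}\bigr)\mathcal U(K)=\mathcal U(K)\mathcal V(K)$ there. 5. Hence the implicit half-period $\mathcal K(x)$ is well defined for $x\in(x_*,2)$: for every such $x$ there is exactly one $K\in(\eta/2,\infty)$ with $\bigl(1-K\frac{\partial}{\partial K}\bigr)\mathcal U(K)=-\frac{\eta x}{2}$. -/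

import Mathlib

open Filter Topology Set

noncomputable section

namespace ImplicitHalfPeriod

/-- The odd elliptic theta function
`ϑ₁₁(z|τ) = i e^{iπ(z + τ/4)} ϑ(z + (1+τ)/2 | τ)`, where
`ϑ(z|τ) = ∑_{n ∈ ℤ} e^{2πinz + iπn²τ}` is Mathlib's `jacobiTheta₂`. -/
def theta11 (z τ : ℂ) : ℂ :=
  Complex.I * Complex.exp (Real.pi * Complex.I * (z + τ / 4)) * jacobiTheta₂ (z + (1 + τ) / 2) τ

/-- The Weierstrass zeta function of a lattice,
`ζ(z) = 1/z + ∑_{l ≠ 0} (1/(z - l) + 1/l + z/l²)`.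
As for Mathlib's `PeriodPair.weierstrassP`, the term at `l = 0` of the sum below is `1/z`,
because division by zero gives zero. -/
def weierstrassZeta (L : PeriodPair) (z : ℂ) : ℂ :=
  ∑' l : L.lattice, (1 / (z - l) + 1 / (l : ℂ) + z / (l : ℂ) ^ 2)

/-- The periods `2K` and `2πi`, i.e. the half-periods `K > 0` and `iπ`. -/
def rectPeriods (K : ℝ) (hK : 0 < K) : PeriodPair where
  ω₁ := 2 * K
  ω₂ := 2 * Real.pi * Complex.I
  indep := by
    rw [LinearIndependent.pair_iff]
    intro s t h
    have h1 := congrArg Complex.re h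
    have h2 := congrArg Complex.im h
    simp at h1 h2
    exact ⟨h1.resolve_right hK.ne', h2⟩

/-- `2K e^{(η/2)(η/(2K) - 1)} ϑ₁₁(η/(2K) | iπ/K) / ϑ₁₁'(0 | iπ/K)`, as a complex number;
`ϑ₁₁'` is the derivative in the first argument. -/
def complexU (η K : ℝ) : ℂ :=
  2 * K * Complex.exp ((η / 2) * (η / (2 * K) - 1)) *
    (theta11 (η / (2 * K)) (Complex.I * Real.pi / K) /
      deriv (fun z : ℂ => theta11 z (Complex.I * Real.pi / K)) 0)

/-- `1 + K ((ζ(η) - η ζ(iπ)/(iπ))² - ℘(η) + 2 ζ(iπ)/(iπ))`, as a complex number, for the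
Weierstrass functions with half-periods `K` and `iπ` (value `0` if `K ≤ 0`). -/
def complexV (η K : ℝ) : ℂ :=
  if hK : 0 < K then
    1 + K * ((weierstrassZeta (rectPeriods K hK) η
          - η * (weierstrassZeta (rectPeriods K hK) (Complex.I * Real.pi)
              / (Complex.I * Real.pi))) ^ 2
        - (rectPeriods K hK).weierstrassP η
        + 2 * (weierstrassZeta (rectPeriods K hK) (Complex.I * Real.pi) / (Complex.I * Real.pi)))
  else 0

/-- The real function `𝓤`. -/
def U (η K : ℝ) : ℝ := (complexU η K).re

/-- The real function `𝓥`. -/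
def V (η K : ℝ) : ℝ := (complexV η K).re

/-- The critical value `x_* = -2 (1 - e^{-η}) / η`. -/
def xStar (η : ℝ) : ℝ := -2 * (1 - Real.exp (-η)) / η

end ImplicitHalfPeriod

end

/-!
Put `q = e^{-2K}`. Everything rests on two facts: `U` is an infinite product in `q`, and
`V = 1 - K L`, where `L = ∂ log U / ∂K`. This gives `(1 - K ∂/∂K) U = U V` at once, and leaves
monotonicity and limits as statements about `L`.

*The product.* The modular transformation of `jacobiTheta₂` turns `ϑ₁₁(· | iπ/K)` into the theta
series `∑ (-1)^k q^{k(k-1)/2} e^{kx}` (`theta11_eq`). The Jacobi triple product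
(`tendsto_triple_product`), obtained from the terminating `q`-binomial theorem by dominated
convergence, gives
`U = (1 - e^{-η}) ∏_{n ≥ 1} (1 - q^n e^η) (1 - q^n e^{-η}) / (1 - q^n)²`. Expanding the logarithm in
powers of `e^η` gives `U = (1 - e^{-η}) exp (-logT η K)` with
`logT η K = ∑_m C_m v_m / m`, where `C_m = 4 sinh² (m η / 2)` and `v_m = q^m / (1 - q^m)` (`U_eq`).
Differentiating, `L = 2 ∑_m C_m u_m = 2 ∑_m sinh² (m η / 2) / sinh² (m K)`, where
`u_m = q^m / (1 - q^m)²`.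

*`V`.* Summing the Weierstrass series along the rows `2nK + 2πi ℤ` with the expansions of `cot` and
its derivative turns them into Lambert series. Then `V = 1 - K L` is an identity of Ramanujan
between the square of one such series and a linear combination of others
(`sq_tsum_v_mul_exp_sub_exp`, `complexV_eq`).

*Monotonicity.* `L > 0`, so `U` increases; `K / sinh² (m K)` decreases for every `m`, so `V`
increases (`logDerivU_lt`). Next, `(U V)' = -K U'' = -K U (L² + L')`, so `U V` increases because `U`
is concave in `K`. This follows from a second identity of the same type (`sq_tsum_u_mul_C`),
`L² + L' = -∑_m C_m u_m (4 coth² (m K) + 8 u_m)`. Both identities are proved by comparing the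
coefficients of `C_m`, where the addition formulas of `coth` make the sums over `j + k = m` and
`j - k = m` telescope.

*Limits.* As `K → ∞`, `logT η K` and `K L` tend to `0`. At `K = η / 2` quasi-periodicity of the theta
series gives `U = (1 - e^{-(2K - η)}) exp (-logT (2K - η) K)`, hence `U / (2K - η) → 1`, while
`(2K - η) L → 2` (`tendsto_mul_logDerivU_half`); so `U V = U - K U L → -η`.
-/

noncomputable section

namespace ImplicitHalfPeriod

/-! ### Rearrangement of double series -/

/-- A symmetric double series without diagonal is twice its part above the diagonal, here
summed along the parallels to the diagonal. -/
theorem tsum_prod_eq_two_mul_of_symm {f : ℕ × ℕ → ℝ} (hf : Summable f)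
    (hsymm : ∀ p, f (Prod.swap p) = f p) (hdiag : ∀ k, f (k, k) = 0) :
    Summable (fun m : ℕ => ∑' k : ℕ, f (k, k + m)) ∧
      ∑' p, f p = 2 * ∑' m : ℕ, ∑' k : ℕ, f (k, k + m) := by
  obtain ⟨g, hg⟩ : ∃ g : ℕ × ℕ → ℝ, ∀ p, g p = if p.1 ≤ p.2 then f p else 0 := ⟨_, fun _ => rfl⟩
  have hgs : Summable g := by
    refine (hf.indicator {p : ℕ × ℕ | p.1 ≤ p.2}).congr fun p => ?_
    simp [hg, Set.indicator_apply]
  have hfg : ∀ p, f p = g p + g p.swap := by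
    rintro ⟨j, k⟩
    have h := hsymm (j, k)
    rcases lt_trichotomy j k with hjk | rfl | hjk
    · simp [hg, hjk.le, hjk.not_ge]
    · simp [hg, hdiag]
    · simpa [hg, hjk.le, hjk.not_ge] using h.symm
  have hswap : Summable (fun p : ℕ × ℕ => g p.swap) := (Equiv.prodComm ℕ ℕ).summable_iff.2 hgs
  have h1 : ∑' p, f p = 2 * ∑' p, g p := by
    have h : ∑' p : ℕ × ℕ, g p.swap = ∑' p, g p := (Equiv.prodComm ℕ ℕ).tsum_eq g
    rw [tsum_congr hfg, hgs.tsum_add hswap, h]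
    ring
  obtain ⟨e, he⟩ : ∃ e : ℕ × ℕ → ℕ × ℕ, ∀ p, e p = (p.2, p.2 + p.1) := ⟨_, fun _ => rfl⟩
  have hinj : Function.Injective e := by
    rintro ⟨a, b⟩ ⟨c, d⟩ h
    simp only [he, Prod.mk.injEq] at h ⊢
    omega
  have hsupp : Function.support g ⊆ Set.range e := by
    rintro ⟨j, k⟩ h
    have hjk : j ≤ k := by
      by_contra hlt
      exact h (by simp [hg, hlt])
    exact ⟨(k - j, j), by simp [he, hjk]⟩
  have hge : ∀ p, g (e p) = f (p.2, p.2 + p.1) := by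
    intro p; simp [hg, he]
  have hs : Summable (fun p : ℕ × ℕ => f (p.2, p.2 + p.1)) := by
    refine (hgs.comp_injective hinj).congr fun p => ?_
    simp [hge]
  have h2 : ∑' p, g p = ∑' p : ℕ × ℕ, f (p.2, p.2 + p.1) := by
    rw [← hinj.tsum_eq hsupp]
    exact tsum_congr hge
  exact ⟨Summable.prod (f := fun p : ℕ × ℕ => f (p.2, p.2 + p.1)) hs, by rw [h1, h2, hs.tsum_prod]⟩

/-- For a sequence `a` decaying faster than `exp (y * m)⁻¹`, the double sums of `a j * a k` against
an even weight of growth at most `exp (y * |t|)`, evaluated at `j + k` and at `j - k`, are rearranged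
into single sums over the value of the argument. -/
theorem bilinear_sums {a : ℕ → ℝ} {C : ℝ → ℝ} {y : ℝ} (ha : ∀ m, 0 ≤ a m)
    (hy : 0 ≤ y) (hs : Summable fun m : ℕ => a m * Real.exp (m * y))
    (hC0 : ∀ t, 0 ≤ C t) (hC : ∀ t, C t ≤ Real.exp (|t| * y)) (hCe : ∀ t, C (-t) = C t)
    (hCz : C 0 = 0) :
    Summable (fun p : ℕ × ℕ => a p.1 * a p.2 * C (p.1 + p.2)) ∧
    Summable (fun p : ℕ × ℕ => a p.1 * a p.2 * C (p.1 - p.2)) ∧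
    Summable (fun m : ℕ => C m * ∑ p ∈ Finset.HasAntidiagonal.antidiagonal m, a p.1 * a p.2) ∧
    Summable (fun m : ℕ => C m * ∑' k : ℕ, a k * a (k + m)) ∧
    ∑' p : ℕ × ℕ, a p.1 * a p.2 * C (p.1 + p.2) =
      ∑' m : ℕ, C m * ∑ p ∈ Finset.HasAntidiagonal.antidiagonal m, a p.1 * a p.2 ∧
    ∑' p : ℕ × ℕ, a p.1 * a p.2 * C (p.1 - p.2) =
      2 * ∑' m : ℕ, C m * ∑' k : ℕ, a k * a (k + m) := by
  have hprod : Summable (fun p : ℕ × ℕ =>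
      (a p.1 * Real.exp (p.1 * y)) * (a p.2 * Real.exp (p.2 * y))) :=
    hs.mul_of_nonneg hs (fun m => mul_nonneg (ha m) (Real.exp_pos _).le)
      (fun m => mul_nonneg (ha m) (Real.exp_pos _).le)
  have hexp : ∀ (j k : ℕ) (t : ℝ), |t| ≤ j + k →
      C t ≤ Real.exp (j * y) * Real.exp (k * y) := by
    intro j k t ht
    rw [← Real.exp_add, ← add_mul]
    exact (hC t).trans (Real.exp_le_exp.2 (mul_le_mul_of_nonneg_right ht hy))
  have hbound : ∀ t : ℕ → ℕ → ℝ, (∀ j k : ℕ, |t j k| ≤ j + k) →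
      Summable (fun p : ℕ × ℕ => a p.1 * a p.2 * C (t p.1 p.2)) := by
    intro t ht
    refine Summable.of_nonneg_of_le
      (fun p => mul_nonneg (mul_nonneg (ha _) (ha _)) (hC0 _)) (fun p => ?_) hprod
    calc a p.1 * a p.2 * C (t p.1 p.2)
        ≤ a p.1 * a p.2 * (Real.exp (p.1 * y) * Real.exp (p.2 * y)) :=
          mul_le_mul_of_nonneg_left (hexp _ _ _ (ht _ _)) (mul_nonneg (ha _) (ha _))
      _ = _ := by ring
  have h1 : Summable (fun p : ℕ × ℕ => a p.1 * a p.2 * C (p.1 + p.2)) :=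
    hbound (fun j k => j + k) fun j k => by rw [abs_of_nonneg (by positivity)]
  have h2 : Summable (fun p : ℕ × ℕ => a p.1 * a p.2 * C (p.1 - p.2)) :=
    hbound (fun j k => j - k) fun j k => by
      rw [abs_le]
      constructor <;> linarith [Nat.cast_nonneg (α := ℝ) j, Nat.cast_nonneg (α := ℝ) k]
  have hanti : ∀ m : ℕ, ∑' p : Finset.HasAntidiagonal.antidiagonal m,
      a p.1.1 * a p.1.2 * C ((p.1.1 : ℝ) + p.1.2) =
      C m * ∑ p ∈ Finset.HasAntidiagonal.antidiagonal m, a p.1 * a p.2 := by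
    intro m
    rw [tsum_fintype, Finset.sum_coe_sort (Finset.HasAntidiagonal.antidiagonal m)
      (fun p : ℕ × ℕ => a p.1 * a p.2 * C ((p.1 : ℝ) + p.2)), Finset.mul_sum]
    refine Finset.sum_congr rfl fun p hp => ?_
    rw [Finset.HasAntidiagonal.mem_antidiagonal] at hp
    rw [← hp]; push_cast; ring
  have h1' := (Finset.HasAntidiagonal.sigmaAntidiagonalEquivProd (A := ℕ)).summable_iff.2 h1
  have hd := tsum_prod_eq_two_mul_of_symm h2
    (fun p => by
      simp only [Prod.fst_swap, Prod.snd_swap]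
      rw [← hCe, neg_sub, mul_comm (a p.2)]) (fun k => by simp [hCz])
  have hk : ∀ m : ℕ, ∑' k : ℕ, a k * a (k + m) * C ((k : ℝ) - ((k + m : ℕ) : ℝ)) =
      C m * ∑' k : ℕ, a k * a (k + m) := by
    intro m
    rw [← tsum_mul_left]
    refine tsum_congr fun k => ?_
    rw [← hCe]
    push_cast
    rw [show -((k : ℝ) - (k + m)) = m by ring]; ring
  refine ⟨h1, h2, ?_, ?_, ?_, ?_⟩
  · refine h1'.sigma.congr fun m => ?_
    rw [← hanti m]; rfl
  · exact hd.1.congr fun m => hk m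
  · rw [← (Finset.HasAntidiagonal.sigmaAntidiagonalEquivProd (A := ℕ)).tsum_eq]
    refine h1'.tsum_sigma.trans ?_
    exact tsum_congr fun m => (hanti m)
  · rw [hd.2]
    exact congrArg _ (tsum_congr hk)

theorem tsum_sub_shift {a : ℕ → ℝ} (ha : Summable a) (m : ℕ) :
    ∑' k, (a k - a (k + m)) = ∑ k ∈ Finset.range m, a k := by
  rw [ha.tsum_sub ((summable_nat_add_iff m).2 ha), ← ha.sum_add_tsum_nat_add m]
  ring

/-! ### Coefficients of the Lambert series -/

/-- `v K m = q^m / (1 - q^m)` for `q = e^{-2K}`; the value at `m = 0` is `0`, as `1 / 0 = 0`. -/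
def v (K : ℝ) (m : ℕ) : ℝ := 1 / (Real.exp (2 * K * m) - 1)

/-- `u K m = q^m / (1 - q^m)² = 1 / (4 sinh² (K m))` for `q = e^{-2K}`, with value `0` at `m = 0`. -/
def u (K : ℝ) (m : ℕ) : ℝ := v K m + v K m ^ 2

/-- `C x t = e^{t x} + e^{-t x} - 2 = 4 sinh² (t x / 2)`. -/
def C (x t : ℝ) : ℝ := Real.exp (t * x) + Real.exp (-(t * x)) - 2

@[simp] theorem v_zero (K : ℝ) : v K 0 = 0 := by simp [v]

@[simp] theorem u_zero (K : ℝ) : u K 0 = 0 := by simp [u]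

@[simp] theorem C_zero_right (x : ℝ) : C x 0 = 0 := by norm_num [C]

theorem C_neg_right (x t : ℝ) : C x (-t) = C x t := by
  simp only [C, neg_mul, neg_neg]; ring

theorem C_neg_left (x t : ℝ) : C (-x) t = C x t := by
  simp only [C, mul_neg, neg_neg]; ring

theorem C_eq_sinh (x t : ℝ) : C x t = 4 * Real.sinh (t * x / 2) ^ 2 := by
  have h : t * x = t * x / 2 + t * x / 2 := by ring
  rw [C, Real.sinh_eq, h, neg_add, Real.exp_add, Real.exp_add]
  have := Real.exp_pos (t * x / 2)
  rw [← h, Real.exp_neg]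
  field_simp
  ring

theorem C_nonneg (x t : ℝ) : 0 ≤ C x t := by rw [C_eq_sinh]; positivity

theorem C_pos {x t : ℝ} (hx : x ≠ 0) (ht : t ≠ 0) : 0 < C x t := by
  have : Real.sinh (t * x / 2) ≠ 0 := by simp [hx, ht]
  rw [C_eq_sinh]; positivity

theorem C_le (x t : ℝ) : C x t ≤ Real.exp (|t| * |x|) := by
  rw [← abs_mul]
  rcases abs_cases (t * x) with ⟨h, h'⟩ | ⟨h, h'⟩ <;> rw [h, C]
  · linarith [Real.exp_le_one_iff.2 (neg_nonpos.2 h')]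
  · linarith [Real.exp_le_one_iff.2 h'.le]

theorem C_mul_C (x s t : ℝ) :
    C x s * C x t = C x (s + t) + C x (s - t) - 2 * C x s - 2 * C x t := by
  simp only [C, add_mul, sub_mul, neg_add, Real.exp_add, Real.exp_sub, Real.exp_neg]
  field_simp
  ring

theorem exp_sub_exp_mul (x s t : ℝ) :
    (Real.exp (s * x) - Real.exp (-(s * x))) * (Real.exp (t * x) - Real.exp (-(t * x))) =
      C x (s + t) - C x (s - t) := by
  simp only [C, add_mul, sub_mul, neg_add, Real.exp_add, Real.exp_sub, Real.exp_neg]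
  field_simp
  ring

section bounds

variable {K : ℝ}

theorem one_lt_exp_mul (hK : 0 < K) {m : ℕ} (hm : m ≠ 0) : 1 < Real.exp (2 * K * m) := by
  rw [Real.one_lt_exp_iff]
  have : (0 : ℝ) < m := by positivity
  positivity

theorem v_nonneg (hK : 0 < K) (m : ℕ) : 0 ≤ v K m := by
  rcases eq_or_ne m 0 with rfl | hm
  · simp
  · exact one_div_nonneg.2 (sub_nonneg.2 (one_lt_exp_mul hK hm).le)

theorem v_pos (hK : 0 < K) {m : ℕ} (hm : m ≠ 0) : 0 < v K m :=
  one_div_pos.2 (sub_pos.2 (one_lt_exp_mul hK hm))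

theorem u_nonneg (hK : 0 < K) (m : ℕ) : 0 ≤ u K m := by
  have := v_nonneg hK m
  rw [u]; positivity

theorem u_pos (hK : 0 < K) {m : ℕ} (hm : m ≠ 0) : 0 < u K m := by
  have := v_pos hK hm
  rw [u]; positivity

/-- The constant of the geometric bounds on `v` and `u`. -/
def decayConst (K : ℝ) : ℝ := 1 / (1 - Real.exp (-(2 * K)))

theorem one_lt_decayConst (hK : 0 < K) : 1 < decayConst K := by
  have h : Real.exp (-(2 * K)) < 1 := Real.exp_lt_one_iff.2 (by linarith)
  rw [decayConst, lt_div_iff₀ (by linarith)]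
  linarith [Real.exp_pos (-(2 * K))]

theorem v_le (hK : 0 < K) (m : ℕ) : v K m ≤ decayConst K * Real.exp (-(2 * K * m)) := by
  have hD := one_lt_decayConst hK
  rcases eq_or_ne m 0 with rfl | hm
  · simp; linarith
  have h : Real.exp (-(2 * K)) < 1 := Real.exp_lt_one_iff.2 (by linarith)
  have h1 := one_lt_exp_mul hK hm
  have h2 : Real.exp (2 * K) ≤ Real.exp (2 * K * m) := by
    apply Real.exp_le_exp.2
    have : (1 : ℝ) ≤ m := by exact_mod_cast Nat.one_le_iff_ne_zero.2 hm
    nlinarith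
  have h3 : 1 ≤ Real.exp (-(2 * K)) * Real.exp (2 * K * m) := by
    calc 1 = Real.exp (-(2 * K)) * Real.exp (2 * K) := by rw [← Real.exp_add]; simp
      _ ≤ _ := by gcongr
  rw [v, decayConst, Real.exp_neg (2 * K * m), ← div_eq_mul_inv, div_div,
    div_le_div_iff₀ (by linarith) (mul_pos (by linarith) (by linarith))]
  nlinarith

theorem u_eq_mul (hK : 0 < K) {m : ℕ} (hm : m ≠ 0) :
    u K m = v K m ^ 2 * Real.exp (2 * K * m) := by
  have h1 := one_lt_exp_mul hK hm
  have : Real.exp (2 * K * m) - 1 ≠ 0 := by linarith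
  rw [u, v]; field_simp; ring

theorem u_le (hK : 0 < K) (m : ℕ) : u K m ≤ decayConst K ^ 2 * Real.exp (-(2 * K * m)) := by
  have hD := one_lt_decayConst hK
  rcases eq_or_ne m 0 with rfl | hm
  · simp; positivity
  have := v_le hK m
  have h0 := v_nonneg hK m
  rw [u_eq_mul hK hm]
  calc v K m ^ 2 * Real.exp (2 * K * m)
      ≤ (decayConst K * Real.exp (-(2 * K * m))) ^ 2 * Real.exp (2 * K * m) := by gcongr
    _ = decayConst K ^ 2 * Real.exp (-(2 * K * m)) *
          (Real.exp (-(2 * K * m)) * Real.exp (2 * K * m)) := by ring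
    _ = _ := by rw [← Real.exp_add]; simp

theorem v_le_decayConst (hK : 0 < K) (m : ℕ) : v K m ≤ decayConst K := by
  refine (v_le hK m).trans ?_
  have hD := one_lt_decayConst hK
  have : Real.exp (-(2 * K * m)) ≤ 1 := Real.exp_le_one_iff.2 (by
    have : (0 : ℝ) ≤ 2 * K * m := by positivity
    linarith)
  nlinarith

theorem v_anti {K K' : ℝ} (hK : 0 < K) (h : K ≤ K') (m : ℕ) : v K' m ≤ v K m := by
  rcases eq_or_ne m 0 with rfl | hm
  · simp
  rw [v, v]
  have := one_lt_exp_mul hK hm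
  apply one_div_le_one_div_of_le (by linarith)
  gcongr

theorem u_anti {K K' : ℝ} (hK : 0 < K) (h : K ≤ K') (m : ℕ) : u K' m ≤ u K m := by
  have h1 := v_anti hK h m
  have h2 := v_nonneg (hK.trans_le h) m
  rw [u, u]; gcongr

theorem summable_pow_mul_exp {K x : ℝ} (hx : |x| < 2 * K) (k : ℕ) :
    Summable fun m : ℕ => (m : ℝ) ^ k * (Real.exp (-(2 * K * m)) * Real.exp (m * |x|)) := by
  refine (Real.summable_pow_mul_exp_neg_nat_mul k (r := 2 * K - |x|) (by linarith)).congr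
    fun m => ?_
  rw [← Real.exp_add]; ring_nf

theorem summable_pow_mul_v_mul_exp {x : ℝ} (hK : 0 < K) (hx : |x| < 2 * K) (k : ℕ) :
    Summable fun m : ℕ => (m : ℝ) ^ k * (v K m * Real.exp (m * |x|)) := by
  refine Summable.of_nonneg_of_le (fun m => ?_) (fun m => ?_)
    ((summable_pow_mul_exp hx k).mul_left (decayConst K))
  · have := v_nonneg hK m
    positivity
  · have := v_le hK m
    calc (m : ℝ) ^ k * (v K m * Real.exp (m * |x|))
        ≤ (m : ℝ) ^ k * (decayConst K * Real.exp (-(2 * K * m)) * Real.exp (m * |x|)) := by gcongr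
      _ = _ := by ring

theorem summable_pow_mul_u_mul_exp {x : ℝ} (hK : 0 < K) (hx : |x| < 2 * K) (k : ℕ) :
    Summable fun m : ℕ => (m : ℝ) ^ k * (u K m * Real.exp (m * |x|)) := by
  refine Summable.of_nonneg_of_le (fun m => ?_) (fun m => ?_)
    ((summable_pow_mul_exp hx k).mul_left (decayConst K ^ 2))
  · have := u_nonneg hK m
    positivity
  · have := u_le hK m
    calc (m : ℝ) ^ k * (u K m * Real.exp (m * |x|))
        ≤ (m : ℝ) ^ k * (decayConst K ^ 2 * Real.exp (-(2 * K * m)) * Real.exp (m * |x|)) := by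
          gcongr
      _ = _ := by ring

theorem summable_pow_mul_v_mul_C {x : ℝ} (hK : 0 < K) (hx : |x| < 2 * K) (k : ℕ) :
    Summable fun m : ℕ => (m : ℝ) ^ k * (v K m * C x m) := by
  refine Summable.of_nonneg_of_le (fun m => ?_) (fun m => ?_) (summable_pow_mul_v_mul_exp hK hx k)
  · have := v_nonneg hK m
    have := C_nonneg x m
    positivity
  · have := v_nonneg hK m
    have h := C_le x m
    rw [Nat.abs_cast] at h
    gcongr

theorem summable_pow_mul_u_mul_C {x : ℝ} (hK : 0 < K) (hx : |x| < 2 * K) (k : ℕ) :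
    Summable fun m : ℕ => (m : ℝ) ^ k * (u K m * C x m) := by
  refine Summable.of_nonneg_of_le (fun m => ?_) (fun m => ?_) (summable_pow_mul_u_mul_exp hK hx k)
  · have := u_nonneg hK m
    have := C_nonneg x m
    positivity
  · have := u_nonneg hK m
    have h := C_le x m
    rw [Nat.abs_cast] at h
    gcongr

theorem summable_pow_mul_v (hK : 0 < K) (k : ℕ) : Summable fun m : ℕ => (m : ℝ) ^ k * v K m := by
  simpa using summable_pow_mul_v_mul_exp (x := 0) hK (by simpa using hK) k

theorem summable_v (hK : 0 < K) : Summable (v K) := by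
  simpa using summable_pow_mul_v hK 0

theorem summable_u (hK : 0 < K) : Summable (u K) := by
  simpa using summable_pow_mul_u_mul_exp (x := 0) hK (by simpa using hK) 0

end bounds

section coefficients

variable {K : ℝ}

theorem exp_mul_add (K : ℝ) (j k : ℕ) :
    Real.exp (2 * K * ((j + k : ℕ) : ℝ)) = Real.exp (2 * K * j) * Real.exp (2 * K * k) := by
  rw [← Real.exp_add]; push_cast; ring_nf

/-- The addition formula of `coth`, in the form that telescopes over `j + k = m`. -/
theorem v_mul_v_add (hK : 0 < K) {j k : ℕ} (hj : j ≠ 0) (hk : k ≠ 0) :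
    v K j * v K k = v K (j + k) * (1 + v K j + v K k) := by
  have h1 := one_lt_exp_mul hK hj
  have h2 := one_lt_exp_mul hK hk
  simp only [v, exp_mul_add]
  generalize Real.exp (2 * K * j) = A at *
  generalize Real.exp (2 * K * k) = B at *
  have hA : A - 1 ≠ 0 := by linarith
  have hB : B - 1 ≠ 0 := by linarith
  have hAB : A * B - 1 ≠ 0 := by nlinarith
  field_simp
  ring

/-- The addition formula for `1 / sinh²`, in the form that telescopes over `j + k = m`. -/
theorem u_mul_u_add (hK : 0 < K) {j k : ℕ} (hj : j ≠ 0) (hk : k ≠ 0) :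
    u K j * u K k =
      u K (j + k) * (u K j + u K k + (1 + 2 * v K (j + k)) * (1 + v K j + v K k)) := by
  have h1 := one_lt_exp_mul hK hj
  have h2 := one_lt_exp_mul hK hk
  simp only [u, v, exp_mul_add]
  generalize Real.exp (2 * K * j) = A at *
  generalize Real.exp (2 * K * k) = B at *
  have hA : A - 1 ≠ 0 := by linarith
  have hB : B - 1 ≠ 0 := by linarith
  have hAB : A * B - 1 ≠ 0 := by nlinarith
  field_simp
  ring

/-- The addition formula of `coth`, in the form that telescopes along `(k, k + m)`. -/
theorem v_mul_v_shift (hK : 0 < K) {m k : ℕ} (hm : m ≠ 0) (hk : k ≠ 0) :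
    v K k * v K (k + m) = v K m * (v K k - v K (k + m)) - v K (k + m) := by
  have := v_mul_v_add hK hk hm
  linarith

/-- The addition formula for `1 / sinh²`, in the form that telescopes along `(k, k + m)`. -/
theorem u_mul_u_shift (hK : 0 < K) {m k : ℕ} (hm : m ≠ 0) (hk : k ≠ 0) :
    u K k * u K (k + m) =
      u K m * (u K k + u K (k + m) - (1 + 2 * v K m) * (v K k - v K (k + m))) := by
  have h1 := one_lt_exp_mul hK hk
  have h2 := one_lt_exp_mul hK hm
  simp only [u, v, exp_mul_add]
  generalize Real.exp (2 * K * k) = A at *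
  generalize Real.exp (2 * K * m) = B at *
  have hA : A - 1 ≠ 0 := by linarith
  have hB : B - 1 ≠ 0 := by linarith
  have hAB : A * B - 1 ≠ 0 := by nlinarith
  field_simp
  ring

theorem sum_antidiagonal_succ_succ {f : ℕ × ℕ → ℝ} (m : ℕ) (h1 : ∀ k, f (0, k) = 0)
    (h2 : ∀ k, f (k, 0) = 0) :
    ∑ p ∈ Finset.HasAntidiagonal.antidiagonal (m + 1), f p =
      ∑ j ∈ Finset.range m, f (j + 1, m - j) := by
  rw [Finset.Nat.sum_antidiagonal_eq_sum_range_succ_mk, Finset.sum_range_succ,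
    Finset.sum_range_succ']
  simp only [h1, h2, Nat.sub_self, add_zero]
  refine Finset.sum_congr rfl fun j _ => ?_
  congr 2
  omega

theorem sum_range_reflect' (a : ℕ → ℝ) (m : ℕ) :
    ∑ j ∈ Finset.range m, a (m - j) = ∑ j ∈ Finset.range m, a (j + 1) := by
  rw [← Finset.sum_range_reflect]
  refine Finset.sum_congr rfl fun j hj => ?_
  rw [Finset.mem_range] at hj
  congr 1
  omega

theorem sum_antidiagonal_v (hK : 0 < K) (m : ℕ) :
    ∑ p ∈ Finset.HasAntidiagonal.antidiagonal (m + 1), v K p.1 * v K p.2 =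
      v K (m + 1) * (m + 2 * ∑ j ∈ Finset.range m, v K (j + 1)) := by
  rw [sum_antidiagonal_succ_succ (f := fun p => v K p.1 * v K p.2) m (by simp) (by simp)]
  have : ∀ j ∈ Finset.range m, v K (j + 1) * v K (m - j) =
      v K (m + 1) * (1 + v K (j + 1) + v K (m - j)) := by
    intro j hj
    rw [Finset.mem_range] at hj
    rw [v_mul_v_add hK (by omega) (by omega)]
    congr 2
    omega
  rw [Finset.sum_congr rfl this, ← Finset.mul_sum, Finset.sum_add_distrib, Finset.sum_add_distrib,
    sum_range_reflect' (v K) m]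
  simp only [Finset.sum_const, Finset.card_range, nsmul_eq_mul, mul_one]
  ring

theorem sum_antidiagonal_u (hK : 0 < K) (m : ℕ) :
    ∑ p ∈ Finset.HasAntidiagonal.antidiagonal (m + 1), u K p.1 * u K p.2 =
      u K (m + 1) * (2 * ∑ j ∈ Finset.range m, u K (j + 1) +
        (1 + 2 * v K (m + 1)) * (m + 2 * ∑ j ∈ Finset.range m, v K (j + 1))) := by
  rw [sum_antidiagonal_succ_succ (f := fun p => u K p.1 * u K p.2) m (by simp) (by simp)]
  have : ∀ j ∈ Finset.range m, u K (j + 1) * u K (m - j) =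
      u K (m + 1) * (u K (j + 1) + u K (m - j) +
        (1 + 2 * v K (m + 1)) * (1 + v K (j + 1) + v K (m - j))) := by
    intro j hj
    rw [Finset.mem_range] at hj
    rw [u_mul_u_add hK (by omega) (by omega), show j + 1 + (m - j) = m + 1 by omega]
  rw [Finset.sum_congr rfl this, ← Finset.mul_sum, Finset.sum_add_distrib, Finset.sum_add_distrib,
    ← Finset.mul_sum, Finset.sum_add_distrib, Finset.sum_add_distrib,
    sum_range_reflect' (v K) m, sum_range_reflect' (u K) m]
  simp only [Finset.sum_const, Finset.card_range, nsmul_eq_mul, mul_one]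
  ring

theorem tsum_sub_shift_succ {a : ℕ → ℝ} (ha : Summable a) (m : ℕ) :
    ∑' k, (a (k + 1) - a (k + 1 + m)) = ∑ k ∈ Finset.range m, a (k + 1) := by
  have := tsum_sub_shift ((summable_nat_add_iff 1).2 ha) m
  rw [← this]
  refine tsum_congr fun k => ?_
  rw [show k + 1 + m = k + m + 1 by ring]

theorem tsum_eq_tsum_succ {a : ℕ → ℝ} (h0 : a 0 = 0) : ∑' k, a k = ∑' k, a (k + 1) := by
  rw [← (Nat.succ_injective).tsum_eq (f := a)]
  rintro (_ | k) hk
  · exact absurd h0 hk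
  · exact ⟨k, rfl⟩

theorem tsum_v_mul_v_shift (hK : 0 < K) {m : ℕ} (hm : m ≠ 0) :
    ∑' k, v K k * v K (k + m) =
      v K m * (∑ k ∈ Finset.range m, v K (k + 1)) - ∑' k, v K (k + 1 + m) := by
  have hs := (summable_nat_add_iff 1).2 (summable_v hK)
  have hs' : Summable fun k => v K (k + 1 + m) :=
    ((summable_nat_add_iff (1 + m)).2 (summable_v hK)).congr fun k => by rw [add_assoc]
  rw [tsum_eq_tsum_succ (by simp), tsum_congr fun k => v_mul_v_shift hK hm (Nat.succ_ne_zero k),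
    Summable.tsum_sub ((hs.sub hs').mul_left _) hs', tsum_mul_left,
    tsum_sub_shift_succ (summable_v hK)]

theorem tsum_u_mul_u_shift (hK : 0 < K) {m : ℕ} (hm : m ≠ 0) :
    ∑' k, u K k * u K (k + m) =
      u K m * (2 * ∑' k, u K k - ∑ k ∈ Finset.range m, u K (k + 1) -
        (1 + 2 * v K m) * ∑ k ∈ Finset.range m, v K (k + 1)) := by
  have hs := (summable_nat_add_iff 1).2 (summable_v hK)
  have hs' : Summable fun k => v K (k + 1 + m) :=
    ((summable_nat_add_iff (1 + m)).2 (summable_v hK)).congr fun k => by rw [add_assoc]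
  have ht := (summable_nat_add_iff 1).2 (summable_u hK)
  have ht' : Summable fun k => u K (k + 1 + m) :=
    ((summable_nat_add_iff (1 + m)).2 (summable_u hK)).congr fun k => by rw [add_assoc]
  have h := tsum_sub_shift_succ (summable_u hK) m
  rw [ht.tsum_sub ht'] at h
  rw [tsum_eq_tsum_succ (by simp), tsum_congr fun k => u_mul_u_shift hK hm (Nat.succ_ne_zero k),
    tsum_mul_left, Summable.tsum_sub (ht.add ht') ((hs.sub hs').mul_left _), tsum_mul_left,
    tsum_sub_shift_succ (summable_v hK), ht.tsum_add ht', tsum_eq_tsum_succ (u_zero K)]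
  linear_combination -u K m * h

end coefficients

/-! ### Two quadratic identities of Ramanujan type -/

section

/-- The logarithmic derivative of `U` in `K`, `∑ 2 u_m C_m = 2 ∑ sinh² (m x / 2) / sinh² (m K)`. -/
def logDerivU (x K : ℝ) : ℝ := ∑' m : ℕ, 2 * (u K m * C x m)

theorem bilinear_sums_C {a : ℕ → ℝ} {x : ℝ} (ha : ∀ m, 0 ≤ a m)
    (hs : Summable fun m : ℕ => a m * Real.exp (m * |x|)) :
    Summable (fun p : ℕ × ℕ => a p.1 * a p.2 * C x (p.1 + p.2)) ∧
    Summable (fun p : ℕ × ℕ => a p.1 * a p.2 * C x (p.1 - p.2)) ∧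
    Summable (fun m : ℕ => C x m * ∑ p ∈ Finset.HasAntidiagonal.antidiagonal m, a p.1 * a p.2) ∧
    Summable (fun m : ℕ => C x m * ∑' k : ℕ, a k * a (k + m)) ∧
    ∑' p : ℕ × ℕ, a p.1 * a p.2 * C x (p.1 + p.2) =
      ∑' m : ℕ, C x m * ∑ p ∈ Finset.HasAntidiagonal.antidiagonal m, a p.1 * a p.2 ∧
    ∑' p : ℕ × ℕ, a p.1 * a p.2 * C x (p.1 - p.2) =
      2 * ∑' m : ℕ, C x m * ∑' k : ℕ, a k * a (k + m) :=
  bilinear_sums ha (abs_nonneg x) hs (C_nonneg x) (C_le x) (C_neg_right x) (C_zero_right x)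

variable {K x : ℝ}

theorem summable_v_mul_exp (hK : 0 < K) (hx : |x| < 2 * K) :
    Summable fun m : ℕ => v K m * Real.exp (m * |x|) := by
  simpa using summable_pow_mul_v_mul_exp hK hx 0

theorem summable_u_mul_exp (hK : 0 < K) (hx : |x| < 2 * K) :
    Summable fun m : ℕ => u K m * Real.exp (m * |x|) := by
  simpa using summable_pow_mul_u_mul_exp hK hx 0

theorem summable_v_mul_C (hK : 0 < K) (hx : |x| < 2 * K) :
    Summable fun m : ℕ => v K m * C x m := by
  simpa using summable_pow_mul_v_mul_C hK hx 0

theorem summable_u_mul_C (hK : 0 < K) (hx : |x| < 2 * K) :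
    Summable fun m : ℕ => u K m * C x m := by
  simpa using summable_pow_mul_u_mul_C hK hx 0

/-- The quadratic identity behind the concavity of `U`. The right-hand side is a single series
whose part growing with `m` is, up to a factor, the derivative of the series squared on the left. -/
theorem sq_tsum_u_mul_C (hK : 0 < K) (hx : |x| < 2 * K) :
    Summable (fun m : ℕ => u K m * C x m *
      (m * (1 + 2 * v K m) - (1 + 2 * v K m) ^ 2 - 2 * u K m)) ∧
    (∑' m, u K m * C x m) ^ 2 = ∑' m : ℕ, u K m * C x m *
      (m * (1 + 2 * v K m) - (1 + 2 * v K m) ^ 2 - 2 * u K m) := by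
  obtain ⟨h1, h2, h3, h4, h5, h6⟩ := bilinear_sums_C (u_nonneg hK) (summable_u_mul_exp hK hx)
  have hC := summable_u_mul_C hK hx
  have hu := summable_u hK
  have hC0 : ∀ m, 0 ≤ u K m * C x m := fun m => mul_nonneg (u_nonneg hK m) (C_nonneg x m)
  have hCC := hC.mul_of_nonneg hC hC0 hC0
  have hCu := hC.mul_of_nonneg hu hC0 (u_nonneg hK)
  have huC := hu.mul_of_nonneg hC (u_nonneg hK) hC0
  have hterm : ∀ m : ℕ, C x m * ∑ p ∈ Finset.HasAntidiagonal.antidiagonal m, u K p.1 * u K p.2 +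
      2 * (C x m * ∑' k : ℕ, u K k * u K (k + m)) - 4 * (∑' k, u K k) * (u K m * C x m) =
      u K m * C x m * (m * (1 + 2 * v K m) - (1 + 2 * v K m) ^ 2 - 2 * u K m) := by
    rintro (_ | m)
    · simp
    · rw [sum_antidiagonal_u hK, tsum_u_mul_u_shift hK (Nat.succ_ne_zero m),
        Finset.sum_range_succ, Finset.sum_range_succ]
      push_cast
      ring
  have hsum := (h3.add (h4.mul_left 2)).sub (hC.mul_left (4 * ∑' k, u K k))
  refine ⟨hsum.congr hterm, ?_⟩
  rw [← tsum_congr hterm, (h3.add (h4.mul_left 2)).tsum_sub (hC.mul_left _),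
    h3.tsum_add (h4.mul_left 2), tsum_mul_left, tsum_mul_left, ← h5, ← h6, sq,
    hC.tsum_mul_tsum hC hCC, ← h1.tsum_add h2]
  have e1 := hC.tsum_mul_tsum hu hCu
  have e2 := hu.tsum_mul_tsum hC huC
  have e3 : 4 * (∑' k, u K k) * ∑' m, u K m * C x m =
      ∑' p : ℕ × ℕ, (2 * (u K p.1 * C x p.1 * u K p.2) + 2 * (u K p.1 * (u K p.2 * C x p.2))) := by
    rw [(hCu.mul_left 2).tsum_add (huC.mul_left 2), tsum_mul_left, tsum_mul_left, ← e1, ← e2]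
    ring
  rw [e3, ← (h1.add h2).tsum_sub ((hCu.mul_left 2).add (huC.mul_left 2))]
  refine tsum_congr fun p => ?_
  linear_combination u K p.1 * u K p.2 * C_mul_C x p.1 p.2

/-- The derivative of `logDerivU x` is minus this sum. -/
def secondSum (x K : ℝ) : ℝ := ∑' m : ℕ, 4 * (m * (u K m * C x m) * (1 + 2 * v K m))

theorem summable_secondSum (hK : 0 < K) (hx : |x| < 2 * K) :
    Summable fun m : ℕ => 4 * (m * (u K m * C x m) * (1 + 2 * v K m)) := by
  have h := summable_pow_mul_u_mul_C hK hx 1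
  refine Summable.of_nonneg_of_le (fun m => ?_) (fun m => ?_)
    (h.mul_left (4 * (1 + 2 * decayConst K)))
  · have := u_nonneg hK m
    have := v_nonneg hK m
    have := C_nonneg x m
    positivity
  · have := u_nonneg hK m
    have := v_nonneg hK m
    have := C_nonneg x m
    have := v_le_decayConst hK m
    calc 4 * (m * (u K m * C x m) * (1 + 2 * v K m))
        ≤ 4 * (m * (u K m * C x m) * (1 + 2 * decayConst K)) := by gcongr
      _ = _ := by ring

/-- Concavity of `U` in `K`: the second derivative of `U` is
`U * (logDerivU ^ 2 - secondSum)`. -/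
theorem logDerivU_sq_lt (hK : 0 < K) (hx0 : x ≠ 0) (hx : |x| < 2 * K) :
    logDerivU x K ^ 2 < secondSum x K := by
  obtain ⟨hs, h⟩ := sq_tsum_u_mul_C hK hx
  rw [logDerivU, tsum_mul_left, mul_pow, h, ← tsum_mul_left, secondSum]
  refine Summable.tsum_lt_tsum (i := 1) (fun m => ?_) ?_ (hs.mul_left _) (summable_secondSum hK hx)
  · have h0 := mul_nonneg (u_nonneg hK m) (C_nonneg x m)
    have hu := u_nonneg hK m
    have : 0 ≤ u K m * C x m * ((1 + 2 * v K m) ^ 2 + 2 * u K m) := by positivity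
    linarith
  · have h0 := mul_pos (u_pos hK one_ne_zero) (C_pos (t := (1 : ℕ)) hx0 (by norm_num))
    have hu := u_nonneg hK 1
    have hv := v_nonneg hK 1
    have : 0 < u K 1 * C x (1 : ℕ) * ((1 + 2 * v K 1) ^ 2 + 2 * u K 1) := by positivity
    linarith

/-- `coth (x / 2) * 2 sinh (m x)` as a finite combination of the values `C x j`, with the
denominator of `coth` cleared. -/
theorem exp_sub_exp_sum (x : ℝ) (m : ℕ) :
    (Real.exp x + 1) * (Real.exp (m * x) - Real.exp (-(m * x))) =
      (Real.exp x - 1) * (C x m + 2 * ∑ j ∈ Finset.range m, C x j + 4 * m) := by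
  induction m with
  | zero => simp
  | succ m ih =>
    rw [Finset.sum_range_succ]
    have h : Real.exp (((m + 1 : ℕ) : ℝ) * x) = Real.exp x * Real.exp (m * x) := by
      rw [← Real.exp_add]; push_cast; ring_nf
    simp only [C, Real.exp_neg, h] at ih ⊢
    have := Real.exp_pos x
    have := Real.exp_pos (m * x)
    generalize ∑ j ∈ Finset.range m, (Real.exp (j * x) + (Real.exp (j * x))⁻¹ - 2) = S at *
    generalize Real.exp x = X at *
    generalize Real.exp (m * x) = Y at *
    push_cast
    field_simp at ih ⊢
    linear_combination X * ih

/-- Ramanujan's identity for the square of the Lambert series of a logarithmic derivative of a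
theta function. -/
theorem sq_tsum_v_mul_exp_sub_exp (hK : 0 < K) (hx0 : x ≠ 0) (hx : |x| < 2 * K) :
    (∑' m : ℕ, v K m * (Real.exp (m * x) - Real.exp (-(m * x)))) ^ 2 -
      (Real.exp x + 1) / (Real.exp x - 1) *
        ∑' m : ℕ, v K m * (Real.exp (m * x) - Real.exp (-(m * x))) =
    ∑' m : ℕ, m * (v K m * C x m) - 4 * ∑' m : ℕ, m * v K m - logDerivU x K := by
  obtain ⟨h1, h2, h3, h4, h5, h6⟩ := bilinear_sums_C (v_nonneg hK) (summable_v_mul_exp hK hx)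
  have hX : Real.exp x - 1 ≠ 0 := by
    rw [sub_ne_zero, Ne, Real.exp_eq_one_iff]; exact hx0
  have hv := summable_v hK
  have hvC := summable_v_mul_C hK hx
  have huC := summable_u_mul_C hK hx
  have hmv : Summable fun m : ℕ => m * v K m := by simpa using summable_pow_mul_v hK 1
  have hmvC : Summable fun m : ℕ => m * (v K m * C x m) := by
    simpa using summable_pow_mul_v_mul_C hK hx 1
  set s : ℕ → ℝ := fun m => Real.exp (m * x) - Real.exp (-(m * x)) with hs
  have hvs : Summable fun m => v K m * s m := by
    refine Summable.of_norm_bounded (summable_v_mul_exp hK hx) fun m => ?_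
    rw [norm_mul, Real.norm_eq_abs, abs_of_nonneg (v_nonneg hK m)]
    refine mul_le_mul_of_nonneg_left ?_ (v_nonneg hK m)
    have e1 : Real.exp (m * x) ≤ Real.exp (m * |x|) := by gcongr; exact le_abs_self x
    have e2 : Real.exp (-(m * x)) ≤ Real.exp (m * |x|) := by
      rw [← mul_neg]; gcongr; exact neg_le_abs x
    rw [Real.norm_eq_abs, abs_le]
    constructor <;> simp only [hs] <;>
      linarith [Real.exp_pos (m * x), Real.exp_pos (-(m * x))]
  have hsq : (∑' m, v K m * s m) ^ 2 =
      ∑' m : ℕ, C x m * ∑ p ∈ Finset.HasAntidiagonal.antidiagonal m, v K p.1 * v K p.2 -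
        2 * ∑' m : ℕ, C x m * ∑' k : ℕ, v K k * v K (k + m) := by
    rw [sq, tsum_mul_tsum_of_summable_norm hvs.norm hvs.norm, ← h5, ← h6, ← h1.tsum_sub h2]
    refine tsum_congr fun p => ?_
    linear_combination v K p.1 * v K p.2 * exp_sub_exp_mul x p.1 p.2
  -- `∑_m v_m ∑_{j < m} C_j` is summed by columns, with `m = j + k + 1`
  have hdouble : Summable fun p : ℕ × ℕ => v K (p.1 + p.2 + 1) * C x p.1 := by
    have hE : Summable fun m : ℕ => Real.exp (-(2 * K * m)) * Real.exp (m * |x|) := by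
      simpa using summable_pow_mul_exp hx 0
    have hE' : Summable fun m : ℕ => Real.exp (-(2 * K * m)) := by
      simpa using summable_pow_mul_exp (K := K) (x := 0) (by simpa using hK) 0
    refine Summable.of_nonneg_of_le (fun p => mul_nonneg (v_nonneg hK _) (C_nonneg x _))
      (fun p => ?_) ((hE.mul_of_nonneg hE' (fun m => by positivity)
        (fun m => by positivity)).mul_left (decayConst K))
    have e1 := v_le hK (p.1 + p.2 + 1)
    have e2 := C_le x p.1
    have e3 := one_lt_decayConst hK
    have e4 : Real.exp (-(2 * K * ((p.1 + p.2 + 1 : ℕ) : ℝ))) ≤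
        Real.exp (-(2 * K * p.1)) * Real.exp (-(2 * K * p.2)) := by
      rw [← Real.exp_add]; apply Real.exp_le_exp.2; push_cast; linarith
    rw [Nat.abs_cast] at e2
    calc v K (p.1 + p.2 + 1) * C x p.1
        ≤ decayConst K * Real.exp (-(2 * K * ((p.1 + p.2 + 1 : ℕ) : ℝ))) *
          Real.exp (p.1 * |x|) := by
          have := C_nonneg x p.1
          gcongr
      _ ≤ decayConst K * (Real.exp (-(2 * K * p.1)) * Real.exp (-(2 * K * p.2))) *
          Real.exp (p.1 * |x|) := by gcongr
      _ = _ := by ring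
  have hdouble' : Summable fun p : ℕ × ℕ => C x p.1 * v K (p.2 + 1 + p.1) :=
    hdouble.congr fun p => by rw [mul_comm, show p.1 + p.2 + 1 = p.2 + 1 + p.1 by ring]
  have hrow : Summable fun m : ℕ => C x m * ∑' k, v K (k + 1 + m) :=
    hdouble'.prod.congr fun m => by dsimp only; rw [tsum_mul_left]
  have hda := (Finset.HasAntidiagonal.sigmaAntidiagonalEquivProd (A := ℕ)).summable_iff.2 hdouble
  have hinner : ∀ m : ℕ, ∑' p : Finset.HasAntidiagonal.antidiagonal m,
      v K (p.1.1 + p.1.2 + 1) * C x p.1.1 = v K (m + 1) * ∑ j ∈ Finset.range (m + 1), C x j := by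
    intro m
    rw [tsum_fintype, Finset.sum_coe_sort (Finset.HasAntidiagonal.antidiagonal m)
      (fun p : ℕ × ℕ => v K (p.1 + p.2 + 1) * C x p.1),
      Finset.Nat.sum_antidiagonal_eq_sum_range_succ_mk, Finset.mul_sum]
    refine Finset.sum_congr rfl fun j hj => ?_
    rw [Finset.mem_range] at hj
    rw [show j + (m - j) = m by omega]
  have hpart : Summable fun m : ℕ => v K m * ∑ j ∈ Finset.range m, C x j := by
    rw [← summable_nat_add_iff 1]
    exact hda.sigma.congr fun m => hinner m
  have hswap : ∑' m : ℕ, v K m * ∑ j ∈ Finset.range m, C x j =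
      ∑' m : ℕ, C x m * ∑' k, v K (k + 1 + m) := by
    have e : ∑' p : ℕ × ℕ, v K (p.1 + p.2 + 1) * C x p.1 =
        ∑' m : ℕ, v K (m + 1) * ∑ j ∈ Finset.range (m + 1), C x j := by
      rw [← (Finset.HasAntidiagonal.sigmaAntidiagonalEquivProd (A := ℕ)).tsum_eq]
      exact hda.tsum_sigma.trans (tsum_congr hinner)
    rw [tsum_eq_tsum_succ (by simp), ← e]
    have e' : ∑' p : ℕ × ℕ, v K (p.1 + p.2 + 1) * C x p.1 =
        ∑' p : ℕ × ℕ, C x p.1 * v K (p.2 + 1 + p.1) :=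
      tsum_congr fun p => by rw [mul_comm, show p.1 + p.2 + 1 = p.2 + 1 + p.1 by ring]
    rw [e', hdouble'.tsum_prod]
    exact tsum_congr fun m => by dsimp only; rw [tsum_mul_left]
  have hcoth : (Real.exp x + 1) / (Real.exp x - 1) * ∑' m, v K m * s m =
      ∑' m, v K m * C x m + 2 * ∑' m : ℕ, C x m * ∑' k, v K (k + 1 + m) +
        4 * ∑' m : ℕ, m * v K m := by
    rw [← hswap, ← tsum_mul_left, ← tsum_mul_left, ← tsum_mul_left,
      ← hvC.tsum_add (hpart.mul_left 2), ← (hvC.add (hpart.mul_left 2)).tsum_add (hmv.mul_left 4)]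
    refine tsum_congr fun m => ?_
    have := exp_sub_exp_sum x m
    simp only [hs]
    field_simp
    linear_combination v K m * this
  have hterm : ∀ m : ℕ,
      C x m * ∑ p ∈ Finset.HasAntidiagonal.antidiagonal m, v K p.1 * v K p.2 -
        2 * (C x m * ∑' k : ℕ, v K k * v K (k + m)) -
        (v K m * C x m + 2 * (C x m * ∑' k, v K (k + 1 + m))) =
      m * (v K m * C x m) - 2 * (u K m * C x m) := by
    rintro (_ | m)
    · simp
    · rw [sum_antidiagonal_v hK, tsum_v_mul_v_shift hK (Nat.succ_ne_zero m),
        Finset.sum_range_succ, u]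
      push_cast
      ring
  rw [hsq, hcoth, logDerivU, sub_right_comm _ (4 * _), ← hmvC.tsum_sub (huC.mul_left 2),
    ← tsum_congr hterm, (h3.sub (h4.mul_left 2)).tsum_sub (hvC.add (hrow.mul_left 2)),
    h3.tsum_sub (h4.mul_left 2), hvC.tsum_add (hrow.mul_left 2), tsum_mul_left, tsum_mul_left]
  ring

end

/-! ### Calculus of the logarithmic derivative -/

/-- `logT x K = -∑ log ((1 - q^n e^x) (1 - q^n e^{-x}) / (1 - q^n)²)` for `q = e^{-2K}`, expanded
into powers of `e^x`. -/
def logT (x K : ℝ) : ℝ := ∑' m : ℕ, C x m / m * v K m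

theorem hasDerivAt_v {K : ℝ} (hK : 0 < K) (m : ℕ) :
    HasDerivAt (fun K => v K m) (-(2 * m * u K m)) K := by
  rcases eq_or_ne m 0 with rfl | hm
  · simpa using hasDerivAt_const K (0 : ℝ)
  have h1 := one_lt_exp_mul hK hm
  have hne : Real.exp (2 * K * m) - 1 ≠ 0 := by linarith
  have h2 : HasDerivAt (fun K : ℝ => Real.exp (2 * K * m) - 1)
      (Real.exp (2 * K * m) * (2 * 1 * m)) K :=
    ((((hasDerivAt_id K).const_mul 2).mul_const (m : ℝ)).exp).sub_const 1
  have h3 := h2.inv hne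
  simp only [v, one_div]
  refine h3.congr_deriv ?_
  rw [u_eq_mul hK hm, v]
  field_simp

theorem hasDerivAt_u {K : ℝ} (hK : 0 < K) (m : ℕ) :
    HasDerivAt (fun K => u K m) (-(2 * m * u K m * (1 + 2 * v K m))) K := by
  have h := hasDerivAt_v hK m
  have h2 := h.add (h.pow 2)
  refine h2.congr_deriv ?_
  push_cast
  ring

theorem exists_between_half {x K : ℝ} (hK : 0 < K) (hx : |x| < 2 * K) :
    ∃ K₀, 0 < K₀ ∧ |x| < 2 * K₀ ∧ K₀ < K := by
  refine ⟨(|x| / 2 + K) / 2, ?_, ?_, ?_⟩ <;> linarith [abs_nonneg x]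

theorem summable_logT {x K : ℝ} (hK : 0 < K) (hx : |x| < 2 * K) :
    Summable fun m : ℕ => C x m / m * v K m := by
  refine Summable.of_nonneg_of_le (fun m => ?_) (fun m => ?_) (summable_v_mul_C hK hx)
  · exact mul_nonneg (div_nonneg (C_nonneg x m) (Nat.cast_nonneg m)) (v_nonneg hK m)
  · rcases eq_or_ne m 0 with rfl | hm
    · simp
    · rw [mul_comm]
      refine mul_le_mul_of_nonneg_left (div_le_self (C_nonneg x m) ?_) (v_nonneg hK m)
      exact_mod_cast Nat.one_le_iff_ne_zero.2 hm

theorem logT_nonneg {x K : ℝ} (hK : 0 < K) : 0 ≤ logT x K :=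
  tsum_nonneg fun m =>
    mul_nonneg (div_nonneg (C_nonneg x m) (Nat.cast_nonneg m)) (v_nonneg hK m)

theorem logT_neg (x K : ℝ) : logT (-x) K = logT x K := by
  simp only [logT, C_neg_left]

theorem hasDerivAt_logT {x K : ℝ} (hK : 0 < K) (hx : |x| < 2 * K) :
    HasDerivAt (logT x) (-logDerivU x K) K := by
  obtain ⟨K₀, h0, hx0, hlt⟩ := exists_between_half hK hx
  have h := hasDerivAt_tsum_of_isPreconnected (𝕜 := ℝ) (F := ℝ)
    (g := fun (m : ℕ) K => C x m / m * v K m)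
    (g' := fun (m : ℕ) K => C x m / m * (-(2 * m * u K m)))
    (u := fun m => 2 * (u K₀ m * C x m)) (t := Ioi K₀) (y₀ := K) (y := K)
    ((summable_u_mul_C h0 hx0).mul_left 2) isOpen_Ioi isPreconnected_Ioi
    (fun m y hy => (hasDerivAt_v (h0.trans hy) m).const_mul _) (fun m y hy => ?_) hlt
    (summable_logT hK hx) hlt
  · refine h.congr_deriv ?_
    rw [logDerivU, ← tsum_neg]
    refine tsum_congr fun m => ?_
    rcases eq_or_ne m 0 with rfl | hm
    · simp
    · have : (m : ℝ) ≠ 0 := by exact_mod_cast hm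
      field_simp
  · have e1 := u_anti h0 (le_of_lt hy) m
    have e2 := u_nonneg (h0.trans hy) m
    have e3 := C_nonneg x m
    rcases eq_or_ne m 0 with rfl | hm
    · simp
    · have : (m : ℝ) ≠ 0 := by exact_mod_cast hm
      rw [show C x m / m * (-(2 * m * u y m)) = -(2 * (u y m * C x m)) by field_simp, norm_neg,
        Real.norm_eq_abs, abs_of_nonneg (by positivity)]
      gcongr

theorem hasDerivAt_logDerivU {x K : ℝ} (hK : 0 < K) (hx : |x| < 2 * K) :
    HasDerivAt (logDerivU x) (-secondSum x K) K := by
  obtain ⟨K₀, h0, hx0, hlt⟩ := exists_between_half hK hx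
  have h := hasDerivAt_tsum_of_isPreconnected (𝕜 := ℝ) (F := ℝ)
    (g := fun (m : ℕ) K => 2 * (u K m * C x m))
    (g' := fun (m : ℕ) K => 2 * (-(2 * m * u K m * (1 + 2 * v K m)) * C x m))
    (u := fun m => 4 * (m * (u K₀ m * C x m) * (1 + 2 * v K₀ m))) (t := Ioi K₀) (y₀ := K) (y := K)
    (summable_secondSum h0 hx0) isOpen_Ioi isPreconnected_Ioi
    (fun m y hy => ((hasDerivAt_u (h0.trans hy) m).mul_const _).const_mul _) (fun m y hy => ?_) hlt
    ((summable_u_mul_C hK hx).mul_left 2) hlt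
  · refine h.congr_deriv ?_
    rw [secondSum, ← tsum_neg]
    exact tsum_congr fun m => by ring
  · have e1 := u_anti h0 (le_of_lt hy) m
    have e2 := u_nonneg (h0.trans hy) m
    have e3 := C_nonneg x m
    have e4 := v_anti h0 (le_of_lt hy) m
    have e5 := v_nonneg (h0.trans hy) m
    have e6 := u_nonneg h0 m
    rw [show 2 * (-(2 * m * u y m * (1 + 2 * v y m)) * C x m) =
      -(4 * (m * (u y m * C x m) * (1 + 2 * v y m))) by ring, norm_neg,
      Real.norm_eq_abs, abs_of_nonneg (by positivity)]
    gcongr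

theorem logDerivU_pos {x K : ℝ} (hK : 0 < K) (hx0 : x ≠ 0) (hx : |x| < 2 * K) :
    0 < logDerivU x K := by
  refine ((summable_u_mul_C hK hx).mul_left 2).tsum_pos (fun m => ?_) 1 ?_
  · have := mul_nonneg (u_nonneg hK m) (C_nonneg x m)
    positivity
  · have := mul_pos (u_pos hK one_ne_zero) (C_pos (t := (1 : ℕ)) hx0 (by norm_num))
    positivity

/-- `1 < 2 y coth y` for `y = K m > 0`: the function `K / sinh² (K m)` decreases. -/
theorem one_lt_two_mul_coth {K : ℝ} (hK : 0 < K) {m : ℕ} (hm : m ≠ 0) :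
    1 < 2 * (K * m) * (1 + 2 * v K m) := by
  have h1 := one_lt_exp_mul hK hm
  have hm' : (0 : ℝ) < m := by positivity
  have ht : 0 < 2 * K * m := by positivity
  have h2 := Real.add_one_le_exp (-(2 * K * m))
  have h3 : Real.exp (-(2 * K * m)) * Real.exp (2 * K * m) = 1 := by rw [← Real.exp_add]; simp
  have h4 : Real.exp (2 * K * m) - 1 < 2 * K * m * (Real.exp (2 * K * m) + 1) := by nlinarith
  have h5 : 2 * (K * m) * (1 + 2 * v K m) =
      2 * K * m * (Real.exp (2 * K * m) + 1) / (Real.exp (2 * K * m) - 1) := by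
    have : Real.exp (2 * K * m) - 1 ≠ 0 := by linarith
    rw [v]; field_simp; ring
  rw [h5, lt_div_iff₀ (by linarith)]
  linarith

/-- `K * logDerivU x K` is decreasing in `K`, because `K / sinh² (m K)` is. -/
theorem logDerivU_lt {x K : ℝ} (hK : 0 < K) (hx0 : x ≠ 0) (hx : |x| < 2 * K) :
    logDerivU x K < K * secondSum x K := by
  rw [logDerivU, secondSum, ← tsum_mul_left]
  have key : ∀ m : ℕ, K * (4 * (m * (u K m * C x m) * (1 + 2 * v K m))) -
      2 * (u K m * C x m) = 2 * (u K m * C x m) * (2 * (K * m) * (1 + 2 * v K m) - 1) := by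
    intro m; ring
  refine Summable.tsum_lt_tsum (i := 1) (fun m => ?_) ?_ ((summable_u_mul_C hK hx).mul_left _)
    ((summable_secondSum hK hx).mul_left K)
  · rcases eq_or_ne m 0 with rfl | hm
    · simp
    rw [← sub_nonneg, key]
    have h := one_lt_two_mul_coth hK hm
    have := mul_nonneg (u_nonneg hK m) (C_nonneg x m)
    exact mul_nonneg (by positivity) (by linarith)
  · rw [← sub_pos, key]
    have h := one_lt_two_mul_coth hK one_ne_zero
    have := mul_pos (u_pos hK one_ne_zero) (C_pos (t := (1 : ℕ)) hx0 (by norm_num))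
    exact mul_pos (by positivity) (by linarith)

theorem tendsto_logT_zero {ι : Type*} {l : Filter ι} {f g : ι → ℝ} {K₀ : ℝ} (hK₀ : 0 < K₀)
    (hf : Tendsto f l (𝓝 0)) (hg : ∀ᶠ i in l, K₀ ≤ g i) :
    Tendsto (fun i => logT (f i) (g i)) l (𝓝 0) := by
  have hcont : ∀ m : ℕ, Tendsto (fun i => C (f i) m / m * v K₀ m) l (𝓝 0) := by
    intro m
    have hc : Continuous fun x => C x m / m * v K₀ m := by unfold C; fun_prop
    have := (hc.tendsto 0).comp hf
    have h0 : C 0 m = 0 := by norm_num [C]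
    simpa [Function.comp_def, h0] using this
  have hsmall : ∀ᶠ i in l, |f i| ≤ K₀ :=
    (((continuous_abs.tendsto 0).comp hf).eventually_le_const (by simpa using hK₀)).mono
      fun i hi => hi
  have := tendsto_tsum_of_dominated_convergence (𝓕 := l)
    (f := fun i (m : ℕ) => C (f i) m / m * v (g i) m) (g := fun _ => (0 : ℝ))
    (bound := fun m : ℕ => (m : ℝ) ^ 0 * (v K₀ m * Real.exp (m * |K₀|)))
    (summable_pow_mul_v_mul_exp hK₀ (by rw [abs_of_pos hK₀]; linarith) 0) (fun m => ?_) ?_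
  · simpa [logT] using this
  · refine squeeze_zero' ?_ ?_ (hcont m)
    · filter_upwards [hg] with i hi
      exact mul_nonneg (div_nonneg (C_nonneg _ m) (Nat.cast_nonneg m))
        (v_nonneg (hK₀.trans_le hi) m)
    · filter_upwards [hg] with i hi
      exact mul_le_mul_of_nonneg_left (v_anti hK₀ hi m)
        (div_nonneg (C_nonneg _ m) (Nat.cast_nonneg m))
  · filter_upwards [hg, hsmall] with i hi hi' m
    have hv := v_nonneg (hK₀.trans_le hi) m
    have hC := C_nonneg (f i) m
    rw [Real.norm_eq_abs, abs_of_nonneg (by positivity), pow_zero, one_mul, mul_comm]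
    have h1 : C (f i) m / m ≤ C (f i) m := by
      rcases eq_or_ne m 0 with rfl | hm
      · simp
      · exact div_le_self hC (by exact_mod_cast Nat.one_le_iff_ne_zero.2 hm)
    have h2 := C_le (f i) m
    rw [Nat.abs_cast] at h2
    have h3 : Real.exp (m * |f i|) ≤ Real.exp (m * |K₀|) := by
      rw [abs_of_pos hK₀]; gcongr
    exact mul_le_mul (v_anti hK₀ hi m) (h1.trans (h2.trans h3)) (by positivity)
      (v_nonneg hK₀ m)

/-- Every term decays at least as fast as the one with `m = 1`, uniformly in `m`. -/
theorem v_le_exp_mul {K₀ K : ℝ} (hK₀ : 0 < K₀) (h : K₀ ≤ K) (m : ℕ) :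
    v K m ≤ Real.exp (-(2 * (K - K₀))) * v K₀ m := by
  rcases eq_or_ne m 0 with rfl | hm
  · simp
  have h1 := one_lt_exp_mul hK₀ hm
  have h2 := one_lt_exp_mul (hK₀.trans_le h) hm
  have h3 : Real.exp (2 * K₀ * m) ≤ Real.exp (-(2 * (K - K₀))) * Real.exp (2 * K * m) := by
    rw [← Real.exp_add]
    apply Real.exp_le_exp.2
    have : (1 : ℝ) ≤ m := by exact_mod_cast Nat.one_le_iff_ne_zero.2 hm
    nlinarith
  have h4 : Real.exp (-(2 * (K - K₀))) ≤ 1 := Real.exp_le_one_iff.2 (by linarith)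
  rw [v, v, mul_one_div, div_le_div_iff₀ (by linarith) (by linarith)]
  linarith

theorem u_le_exp_mul {K₀ K : ℝ} (hK₀ : 0 < K₀) (h : K₀ ≤ K) (m : ℕ) :
    u K m ≤ Real.exp (-(2 * (K - K₀))) * u K₀ m := by
  have h1 := v_le_exp_mul hK₀ h m
  have h2 := v_anti hK₀ h m
  have h3 := v_nonneg (hK₀.trans_le h) m
  rw [u, u]
  nlinarith [v_nonneg hK₀ m]

theorem tendsto_mul_logDerivU_atTop (x : ℝ) :
    Tendsto (fun K => K * logDerivU x K) atTop (𝓝 0) := by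
  obtain ⟨K₀, hK₀, hx⟩ : ∃ K₀, 0 < K₀ ∧ |x| < 2 * K₀ :=
    ⟨|x| / 2 + 1, by positivity, by linarith⟩
  have h1 : Tendsto (fun K : ℝ => K ^ 1 * Real.exp (-K) * (Real.exp (2 * K₀) * logDerivU x K₀))
      atTop (𝓝 0) := by
    simpa using (Real.tendsto_pow_mul_exp_neg_atTop_nhds_zero 1).mul_const
      (Real.exp (2 * K₀) * logDerivU x K₀)
  refine squeeze_zero' ?_ ?_ h1
  · filter_upwards [eventually_ge_atTop K₀] with K hK
    refine mul_nonneg (hK₀.le.trans hK) (tsum_nonneg fun m => ?_)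
    have := mul_nonneg (u_nonneg (hK₀.trans_le hK) m) (C_nonneg x m)
    positivity
  · filter_upwards [eventually_ge_atTop K₀] with K hK
    have hKp := hK₀.trans_le hK
    have h2 : logDerivU x K ≤ Real.exp (-(2 * (K - K₀))) * logDerivU x K₀ := by
      rw [logDerivU, logDerivU, ← tsum_mul_left]
      refine Summable.tsum_le_tsum (fun m => ?_)
        ((summable_u_mul_C hKp (by linarith)).mul_left 2)
        (((summable_u_mul_C hK₀ hx).mul_left 2).mul_left _)
      have := mul_le_mul_of_nonneg_right (u_le_exp_mul hK₀ hK m) (C_nonneg x m)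
      linarith
    have h3 : 0 ≤ logDerivU x K₀ := tsum_nonneg fun m => by
      have := mul_nonneg (u_nonneg hK₀ m) (C_nonneg x m)
      positivity
    calc K * logDerivU x K ≤ K * (Real.exp (-(2 * (K - K₀))) * logDerivU x K₀) := by gcongr
      _ ≤ K * (Real.exp (-K + 2 * K₀) * logDerivU x K₀) := by gcongr; linarith
      _ = _ := by rw [Real.exp_add]; ring

theorem tendsto_logT_atTop (x : ℝ) : Tendsto (fun K => logT x K) atTop (𝓝 0) := by
  obtain ⟨K₀, hK₀, hx⟩ : ∃ K₀, 0 < K₀ ∧ |x| < 2 * K₀ :=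
    ⟨|x| / 2 + 1, by positivity, by linarith⟩
  have h1 : Tendsto (fun K : ℝ => Real.exp (-(2 * (K - K₀))) * logT x K₀) atTop (𝓝 0) := by
    have : Tendsto (fun K : ℝ => Real.exp (-(2 * (K - K₀)))) atTop (𝓝 0) := by
      refine Real.tendsto_exp_neg_atTop_nhds_zero.comp ?_
      exact (tendsto_atTop_add_const_right atTop (-K₀) tendsto_id).const_mul_atTop two_pos
    simpa using this.mul_const (logT x K₀)
  refine squeeze_zero' ?_ ?_ h1
  · filter_upwards [eventually_ge_atTop K₀] with K hK
    exact logT_nonneg (hK₀.trans_le hK)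
  · filter_upwards [eventually_ge_atTop K₀] with K hK
    rw [logT, logT, ← tsum_mul_left]
    refine Summable.tsum_le_tsum (fun m => ?_) (summable_logT (hK₀.trans_le hK) (by linarith))
      ((summable_logT hK₀ hx).mul_left _)
    have := mul_le_mul_of_nonneg_left (v_le_exp_mul hK₀ hK m)
      (div_nonneg (C_nonneg x m) (Nat.cast_nonneg m))
    linarith

/-! ### The logarithmic derivative at its singularity -/

/-- Each term `u_m C_m` of the logarithmic derivative is close to `e^{-m (2 K - x)}`, with an error
summable in `m` uniformly in `K`. -/
theorem abs_exp_sub_u_mul_C_le {x K : ℝ} (hx : 0 < x) (hK : x < 2 * K) (m : ℕ) (hm : m ≠ 0) :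
    |Real.exp (-(m * (2 * K - x))) - u K m * C x m| ≤
      2 / (1 - Real.exp (-x)) * Real.exp (-(m * x)) := by
  have hK0 : 0 < K := by linarith
  have hm1 : (1 : ℝ) ≤ m := by exact_mod_cast Nat.one_le_iff_ne_zero.2 hm
  obtain ⟨a, ha⟩ : ∃ a, a = Real.exp (-(m * x)) := ⟨_, rfl⟩
  obtain ⟨b, hb⟩ : ∃ b, b = Real.exp (-(2 * K * m)) := ⟨_, rfl⟩
  obtain ⟨e, he⟩ : ∃ e, e = Real.exp (-x) := ⟨_, rfl⟩
  have ha0 : 0 < a := ha ▸ Real.exp_pos _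
  have hb0 : 0 < b := hb ▸ Real.exp_pos _
  have hba : b < a := by rw [ha, hb]; apply Real.exp_lt_exp.2; nlinarith
  have hae : a ≤ e := by rw [ha, he]; apply Real.exp_le_exp.2; nlinarith
  have he1 : e < 1 := by rw [he]; exact Real.exp_lt_one_iff.2 (by linarith)
  have h1 : Real.exp (m * x) = a⁻¹ := by rw [ha, Real.exp_neg, inv_inv]
  have h2 : Real.exp (2 * K * m) = b⁻¹ := by rw [hb, Real.exp_neg, inv_inv]
  have h3 : Real.exp (-(m * (2 * K - x))) = b / a := by
    rw [ha, hb, ← Real.exp_sub]; ring_nf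
  have hb1 : (1 - b) ≠ 0 := by linarith
  have h4 : u K m * C x m = b / a * ((1 - a) / (1 - b)) ^ 2 := by
    have : b⁻¹ - 1 ≠ 0 := by
      have : b⁻¹ - 1 = (1 - b) / b := by field_simp
      rw [this]; positivity
    rw [u_eq_mul hK0 hm, v, C, ← ha, h1, h2]
    field_simp
    ring
  rw [h3, h4, ← ha, ← he]
  set r := (1 - a) / (1 - b) with hr
  have hr0 : 0 ≤ r := div_nonneg (by linarith) (by linarith)
  have hr1 : r ≤ 1 := (div_le_one (by linarith)).2 (by linarith)
  have hr2 : 1 - r ≤ a / (1 - e) := by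
    have : 1 - r = (a - b) / (1 - b) := by rw [hr]; field_simp; ring
    rw [this]
    exact div_le_div₀ ha0.le (by linarith) (by linarith) (by linarith)
  have hr3 : 0 ≤ b / a := by positivity
  have hr4 : b / a ≤ 1 := (div_le_one ha0).2 hba.le
  rw [show b / a - b / a * r ^ 2 = b / a * ((1 - r) * (1 + r)) by ring, abs_of_nonneg
    (mul_nonneg hr3 (mul_nonneg (by linarith) (by linarith)))]
  calc b / a * ((1 - r) * (1 + r)) ≤ 1 * (a / (1 - e) * 2) := by
        have : 0 ≤ a / (1 - e) := div_nonneg ha0.le (by linarith)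
        refine mul_le_mul hr4 (mul_le_mul hr2 (by linarith) (by linarith) this)
          (mul_nonneg (by linarith) (by linarith)) zero_le_one
    _ = _ := by ring

theorem hasSum_exp_succ {d : ℝ} (hd : 0 < d) :
    HasSum (fun m : ℕ => Real.exp (-(((m + 1 : ℕ) : ℝ) * d))) (1 / (Real.exp d - 1)) := by
  have h1 : Real.exp (-d) < 1 := Real.exp_lt_one_iff.2 (by linarith)
  have h := (hasSum_geometric_of_lt_one (Real.exp_pos (-d)).le h1).mul_left (Real.exp (-d))
  have he : Real.exp (-d) * (1 - Real.exp (-d))⁻¹ = 1 / (Real.exp d - 1) := by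
    have : 1 < Real.exp d := Real.one_lt_exp_iff.2 hd
    have h2 : Real.exp d - 1 ≠ 0 := by linarith
    rw [Real.exp_neg]
    field_simp
  rw [he] at h
  refine h.congr_fun ?_
  intro m
  rw [← Real.exp_nat_mul, ← Real.exp_add]
  push_cast; ring_nf

/-- Near `2 K = x` only the factor with a zero there contributes an unbounded term to the
logarithmic derivative. -/
theorem abs_logDerivU_sub_le {x K : ℝ} (hx : 0 < x) (hK : x < 2 * K) :
    |logDerivU x K - 2 / (Real.exp (2 * K - x) - 1)| ≤
      4 / (1 - Real.exp (-x)) * (1 / (Real.exp x - 1)) := by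
  have hK0 : 0 < K := by linarith
  have hd : 0 < 2 * K - x := by linarith
  have hs := (summable_nat_add_iff 1).2
    ((summable_u_mul_C (x := x) hK0 (by rwa [abs_of_pos hx])).mul_left 2)
  have h1 := ((hasSum_exp_succ hd).mul_left 2)
  have h2 := ((hasSum_exp_succ hx).mul_left (4 / (1 - Real.exp (-x))))
  have h3 : logDerivU x K - 2 / (Real.exp (2 * K - x) - 1) =
      ∑' m : ℕ, (2 * (u K (m + 1) * C x ((m + 1 : ℕ) : ℝ)) -
        2 * Real.exp (-(((m + 1 : ℕ) : ℝ) * (2 * K - x)))) := by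
    rw [hs.tsum_sub h1.summable, h1.tsum_eq, logDerivU, tsum_eq_tsum_succ (by simp)]
    ring
  rw [h3, ← h2.tsum_eq, ← Real.norm_eq_abs]
  refine tsum_of_norm_bounded h2.summable.hasSum fun m => ?_
  have := abs_exp_sub_u_mul_C_le hx hK (m + 1) (Nat.succ_ne_zero m)
  rw [← mul_sub, norm_mul, Real.norm_eq_abs, Real.norm_eq_abs, abs_sub_comm, abs_two]
  calc _ ≤ 2 * _ := mul_le_mul_of_nonneg_left this two_pos.le
    _ = _ := by ring

theorem tendsto_mul_logDerivU_half {x : ℝ} (hx : 0 < x) :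
    Tendsto (fun K => (2 * K - x) * logDerivU x K) (𝓝[>] (x / 2)) (𝓝 2) := by
  have hd : Tendsto (fun K => 2 * K - x) (𝓝[>] (x / 2)) (𝓝[≠] 0) := by
    refine tendsto_nhdsWithin_iff.2 ⟨?_, ?_⟩
    · have : Continuous fun K : ℝ => 2 * K - x := by fun_prop
      have h := this.tendsto (x / 2)
      rw [show 2 * (x / 2) - x = 0 by ring] at h
      exact h.mono_left nhdsWithin_le_nhds
    · filter_upwards [self_mem_nhdsWithin] with K hK
      have : x / 2 < K := hK
      simp only [mem_compl_iff, mem_singleton_iff]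
      linarith
  have h1 : Tendsto (fun d : ℝ => d * (2 / (Real.exp d - 1))) (𝓝[≠] 0) (𝓝 2) := by
    have h := (hasDerivAt_iff_tendsto_slope.1 (Real.hasDerivAt_exp 0)).inv₀ (by simp)
    have h' := h.const_mul 2
    simp only [Real.exp_zero, inv_one, mul_one] at h'
    refine h'.congr' ?_
    filter_upwards with d
    simp only [slope_def_field, Real.exp_zero, sub_zero, inv_div]
    ring
  have h2 := h1.comp hd
  have h3 : Tendsto (fun K => (2 * K - x) *
      (logDerivU x K - 2 / (Real.exp (2 * K - x) - 1))) (𝓝[>] (x / 2)) (𝓝 0) := by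
    refine (hd.mono_right nhdsWithin_le_nhds).zero_mul_isBoundedUnder_le ?_
    refine isBoundedUnder_of_eventually_le
      (a := 4 / (1 - Real.exp (-x)) * (1 / (Real.exp x - 1))) ?_
    filter_upwards [self_mem_nhdsWithin] with K hK
    have : x / 2 < K := hK
    exact abs_logDerivU_sub_le hx (by linarith)
  have h4 := h3.add h2
  rw [zero_add] at h4
  refine h4.congr fun K => ?_
  simp only [Function.comp]
  ring

/-! ### The terminating `q`-binomial theorem -/

section

/-- The finite `q`-Pochhammer symbol `∏_{i=1}^{n} (1 - q^i)` for `q = e^{-2K}`. -/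
def poch (K : ℝ) (n : ℕ) : ℝ := ∏ i ∈ Finset.range n, (1 - Real.exp (-(2 * K * (i + 1))))

variable {K : ℝ}

theorem poch_succ (K : ℝ) (n : ℕ) :
    poch K (n + 1) = poch K n * (1 - Real.exp (-(2 * K * (n + 1)))) := by
  rw [poch, Finset.prod_range_succ, poch]

theorem one_sub_exp_pos (hK : 0 < K) (n : ℕ) : 0 < 1 - Real.exp (-(2 * K * (n + 1))) := by
  have : Real.exp (-(2 * K * (n + 1))) < 1 := Real.exp_lt_one_iff.2 (by
    have : 0 < 2 * K * (n + 1) := by positivity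
    linarith)
  linarith

theorem poch_pos (hK : 0 < K) (n : ℕ) : 0 < poch K n :=
  Finset.prod_pos fun i _ => one_sub_exp_pos hK i

theorem poch_antitone (hK : 0 < K) : Antitone (poch K) := by
  refine antitone_nat_of_succ_le fun n => ?_
  rw [poch_succ]
  have h1 := poch_pos hK n
  have h2 := Real.exp_pos (-(2 * K * ((n : ℝ) + 1)))
  nlinarith

/-- The infinite product `∏_{i ≥ 1} (1 - q^i)` for `q = e^{-2K}`. -/
def pochInf (K : ℝ) : ℝ := ∏' i : ℕ, (1 - Real.exp (-(2 * K * (i + 1))))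

/-- The product converges to a positive limit, so it is not the junk value of `∏'`. -/
theorem tendsto_poch (hK : 0 < K) : Tendsto (poch K) atTop (𝓝 (pochInf K)) ∧ 0 < pochInf K := by
  have hs : Summable fun i : ℕ => Real.log (1 - Real.exp (-(2 * K * (i + 1)))) := by
    have h : Summable fun i : ℕ => -Real.exp (-(2 * K * ((i : ℝ) + 1))) := by
      have := (hasSum_exp_succ (d := 2 * K) (by linarith)).summable.neg
      refine this.congr fun m => ?_
      push_cast; ring_nf
    have := Real.summable_log_one_add_of_summable h
    exact this.congr fun i => by rw [← sub_eq_add_neg]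
  have hp := Real.hasProd_of_hasSum_log (one_sub_exp_pos hK) hs.hasSum
  have hp' : pochInf K = _ := hp.tprod_eq
  rw [hp']
  exact ⟨hp.tendsto_prod_nat, Real.exp_pos _⟩

theorem pochInf_le (hK : 0 < K) (n : ℕ) : pochInf K ≤ poch K n :=
  (poch_antitone hK).le_of_tendsto (tendsto_poch hK).1 n

/-- The terminating `q`-binomial theorem of Gauss, for `q = e^{-2K}`. -/
theorem gauss_binomial (hK : 0 < K) (M : ℕ) (y : ℝ) :
    ∏ n ∈ Finset.range M, (1 - Real.exp (-(2 * K * n)) * y) =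
      ∑ k ∈ Finset.range (M + 1), (-1) ^ k * Real.exp (-(K * (k * (k - 1)))) * y ^ k *
        (poch K M / (poch K k * poch K (M - k))) := by
  induction M generalizing y with
  | zero => simp [poch]
  | succ M ih =>
    have hy : ∏ n ∈ Finset.range (M + 1), (1 - Real.exp (-(2 * K * n)) * y) =
        (1 - y) * ∏ n ∈ Finset.range M, (1 - Real.exp (-(2 * K * n)) * (Real.exp (-(2 * K)) * y)) := by
      rw [Finset.prod_range_succ', mul_comm]
      congr 1
      · simp
      · refine Finset.prod_congr rfl fun n _ => ?_
        rw [← mul_assoc, ← Real.exp_add]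
        push_cast; ring_nf
    rw [hy, ih]
    obtain ⟨c, hc⟩ : ∃ c : ℕ → ℝ, ∀ k, c k = (-1) ^ k * Real.exp (-(K * (k * (k - 1)))) *
        (Real.exp (-(2 * K)) * y) ^ k * (poch K M / (poch K k * poch K (M - k))) :=
      ⟨_, fun _ => rfl⟩
    simp only [← hc]
    have hsplit : (1 - y) * ∑ k ∈ Finset.range (M + 1), c k =
        (∑ k ∈ Finset.range M, c (k + 1) - ∑ k ∈ Finset.range M, y * c k) + -(y * c M) + c 0 := by
      rw [sub_mul, one_mul, ← Finset.mul_sum]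
      nth_rewrite 1 [Finset.sum_range_succ']
      rw [Finset.sum_range_succ]
      ring
    rw [hsplit, Finset.sum_range_succ' _ (M + 1), Finset.sum_range_succ _ M]
    have hp := poch_pos hK
    -- the top, bottom and middle coefficients of the `q`-Pascal recursion
    have hlast : -(y * c M) = (-1) ^ (M + 1) *
        Real.exp (-(K * (((M + 1 : ℕ) : ℝ) * (((M + 1 : ℕ) : ℝ) - 1)))) * y ^ (M + 1) *
        (poch K (M + 1) / (poch K (M + 1) * poch K (M + 1 - (M + 1)))) := by
      have e : Real.exp (-(K * (((M + 1 : ℕ) : ℝ) * (((M + 1 : ℕ) : ℝ) - 1)))) =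
          Real.exp (-(K * (M * (M - 1)))) * Real.exp (-(2 * K)) ^ M := by
        rw [← Real.exp_nat_mul, ← Real.exp_add]; push_cast; ring_nf
      have h1 := (hp M).ne'
      have h2 := (hp (M + 1)).ne'
      have h0 : poch K 0 = 1 := by simp [poch]
      rw [hc, e, Nat.sub_self, Nat.sub_self, h0]
      field_simp
      ring
    have hfirst : c 0 = (-1) ^ 0 * Real.exp (-(K * (((0 : ℕ) : ℝ) * (((0 : ℕ) : ℝ) - 1)))) * y ^ 0 *
        (poch K (M + 1) / (poch K 0 * poch K (M + 1 - 0))) := by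
      have h0 : poch K 0 = 1 := by simp [poch]
      rw [hc]
      simp [h0, (hp M).ne', (hp (M + 1)).ne']
    have hmid : ∑ k ∈ Finset.range M, c (k + 1) - ∑ k ∈ Finset.range M, y * c k =
        ∑ k ∈ Finset.range M, (-1) ^ (k + 1) *
          Real.exp (-(K * (((k + 1 : ℕ) : ℝ) * (((k + 1 : ℕ) : ℝ) - 1)))) * y ^ (k + 1) *
          (poch K (M + 1) / (poch K (k + 1) * poch K (M + 1 - (k + 1)))) := by
      rw [← Finset.sum_sub_distrib]
      refine Finset.sum_congr rfl fun k hk => ?_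
      rw [Finset.mem_range] at hk
      obtain ⟨j, rfl⟩ : ∃ j, M = k + 1 + j := ⟨M - (k + 1), by omega⟩
      have e : Real.exp (-(K * (((k + 1 : ℕ) : ℝ) * (((k + 1 : ℕ) : ℝ) - 1)))) =
          Real.exp (-(K * (k * (k - 1)))) * Real.exp (-(2 * K)) ^ k := by
        rw [← Real.exp_nat_mul, ← Real.exp_add]; push_cast; ring_nf
      rw [hc, hc, e, show k + 1 + j - (k + 1) = j by omega, show k + 1 + j - k = j + 1 by omega,
        show k + 1 + j + 1 - (k + 1) = j + 1 by omega, poch_succ K (k + 1 + j), poch_succ K j,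
        poch_succ K k]
      have h1 := (hp k).ne'
      have h2 := (hp j).ne'
      have h3 := (one_sub_exp_pos hK k).ne'
      have h4 := (one_sub_exp_pos hK j).ne'
      have e1 : Real.exp (-(2 * K * (((k + 1 + j : ℕ) : ℝ) + 1))) =
          Real.exp (-(2 * K * (k + 1))) * Real.exp (-(2 * K * (j + 1))) := by
        rw [← Real.exp_add]; push_cast; ring_nf
      have e2 : Real.exp (-(2 * K)) ^ (k + 1) = Real.exp (-(2 * K * (k + 1))) := by
        rw [← Real.exp_nat_mul]; push_cast; ring_nf
      rw [e1, mul_pow _ y (k + 1), e2, mul_pow _ y k, pow_succ y, pow_succ (-1 : ℝ)]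
      generalize Real.exp (-(2 * K * (k + 1))) = A at *
      generalize Real.exp (-(2 * K * (j + 1))) = B at *
      field_simp
      ring
    rw [← hmid, ← hlast, ← hfirst]

end

/-! ### The Jacobi triple product -/

section

variable {K x : ℝ}

/-- The terms of the theta series `∑ (-1)^k q^{k (k - 1) / 2} e^{k x}` for `q = e^{-2K}`. -/
def thetaTerm (K x : ℝ) (k : ℤ) : ℝ :=
  (-1) ^ k * Real.exp (-(K * (k * (k - 1)))) * Real.exp (k * x)

/-- The theta series `∑ (-1)^k q^{k (k - 1) / 2} e^{k x}` for `q = e^{-2K}`. -/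
def thetaSeries (K x : ℝ) : ℝ := ∑' k : ℤ, thetaTerm K x k

/-- On the dual imaginary period `iK/π` the terms of Mathlib's theta series are real. -/
theorem jacobiTheta₂_term_eq (K x : ℝ) (k : ℤ) :
    jacobiTheta₂_term k (-(Complex.I * (x + K)) / (2 * Real.pi) + 1 / 2)
      (Complex.I * K / Real.pi) = (thetaTerm K x k : ℂ) := by
  have hpi : (Real.pi : ℂ) ≠ 0 := by exact_mod_cast Real.pi_ne_zero
  have h : 2 * (Real.pi : ℂ) * Complex.I * k *
        (-(Complex.I * (x + K)) / (2 * Real.pi) + 1 / 2) +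
      Real.pi * Complex.I * k ^ 2 * (Complex.I * K / Real.pi) =
      k * (Real.pi * Complex.I) + (-(K * (k * (k - 1))) + k * x) := by
    field_simp
    linear_combination ((k : ℂ) ^ 2 * K - (k : ℂ) * (x + K)) * Complex.I_sq
  rw [jacobiTheta₂_term, h, Complex.exp_add, Complex.exp_int_mul, Complex.exp_pi_mul_I,
    Complex.exp_add, thetaTerm]
  push_cast
  ring

theorem im_dual_period_pos (hK : 0 < K) : 0 < (Complex.I * K / Real.pi).im := by
  have : Complex.I * K / Real.pi = ((K / Real.pi : ℝ) : ℂ) * Complex.I := by push_cast; ring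
  rw [this]
  simpa using div_pos hK Real.pi_pos

theorem hasSum_thetaTerm (hK : 0 < K) (x : ℝ) :
    HasSum (fun k => (thetaTerm K x k : ℂ)) (jacobiTheta₂
      (-(Complex.I * (x + K)) / (2 * Real.pi) + 1 / 2) (Complex.I * K / Real.pi)) :=
  (hasSum_jacobiTheta₂_term _ (im_dual_period_pos hK)).congr_fun
    (fun k => (jacobiTheta₂_term_eq K x k).symm)

theorem summable_thetaTerm (hK : 0 < K) (x : ℝ) : Summable (thetaTerm K x) :=
  Complex.summable_ofReal.1 (hasSum_thetaTerm hK x).summable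

theorem thetaSeries_eq (hK : 0 < K) (x : ℝ) :
    jacobiTheta₂ (-(Complex.I * (x + K)) / (2 * Real.pi) + 1 / 2) (Complex.I * K / Real.pi) =
      (thetaSeries K x : ℂ) := by
  rw [← (hasSum_thetaTerm hK x).tsum_eq, thetaSeries, Complex.ofReal_tsum]

/-- Quasi-periodicity of the theta series. -/
theorem thetaSeries_sub (K x : ℝ) :
    thetaSeries K (x - 2 * K) = -Real.exp (-x) * thetaSeries K x := by
  rw [thetaSeries, thetaSeries, ← (Equiv.addRight (1 : ℤ)).tsum_eq (thetaTerm K x),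
    ← tsum_mul_left]
  refine tsum_congr fun k => ?_
  simp only [Equiv.coe_addRight, thetaTerm]
  rw [zpow_add_one₀ (by norm_num)]
  have h : Real.exp (-(K * (k * (k - 1)))) * Real.exp (k * (x - 2 * K)) =
      Real.exp (-x) * (Real.exp (-(K * (((k + 1 : ℤ) : ℝ) * (((k + 1 : ℤ) : ℝ) - 1)))) *
        Real.exp (((k + 1 : ℤ) : ℝ) * x)) := by
    rw [← Real.exp_add, ← Real.exp_add, ← Real.exp_add]
    push_cast; ring_nf
  linear_combination (-1) ^ k * h

/-- The terms of the finite form of the triple product: truncations of `thetaTerm` weighted with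
`q`-binomial coefficients. -/
def truncTerm (K x : ℝ) (N : ℕ) (j : ℤ) : ℝ :=
  if -(N : ℤ) ≤ j ∧ j ≤ N then
    thetaTerm K x j * (poch K (2 * N) / (poch K (N + j).toNat * poch K (N - j).toNat)) else 0

/-- The finite form of the Jacobi triple product. -/
theorem finite_triple_product (hK : 0 < K) (x : ℝ) (N : ℕ) :
    (∏ n ∈ Finset.range N, (1 - Real.exp (-(2 * K * n) + x))) *
      ∏ n ∈ Finset.range N, (1 - Real.exp (-(2 * K * (n + 1)) - x)) =
    ∑' j : ℤ, truncTerm K x N j := by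
  have hsum : ∑' j : ℤ, truncTerm K x N j = ∑ k ∈ Finset.range (2 * N + 1),
      thetaTerm K x ((k : ℤ) - N) *
        (poch K (2 * N) / (poch K k * poch K (2 * N - k))) := by
    have hinj : Function.Injective fun k : ℕ => (k : ℤ) - N := fun a b h => by
      simp only at h; omega
    rw [tsum_eq_sum (s := (Finset.range (2 * N + 1)).image fun k : ℕ => (k : ℤ) - N),
      Finset.sum_image hinj.injOn]
    · refine Finset.sum_congr rfl fun k hk => ?_
      rw [Finset.mem_range] at hk
      rw [truncTerm, if_pos (by omega)]
      congr 4 <;> omega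
    · intro j hj
      rw [truncTerm, if_neg]
      intro h
      refine hj (Finset.mem_image.2 ⟨(j + N).toNat, Finset.mem_range.2 ?_, ?_⟩) <;> omega
  -- with `2 N` factors and this argument, the substitution `k = N + j` centres the sum at `j = 0`
  have hg := gauss_binomial hK (2 * N) (Real.exp (x + 2 * K * N))
  obtain ⟨c, hc⟩ : ∃ c, c = (-1) ^ N * Real.exp (K * (N * (N + 1)) + N * x) := ⟨_, rfl⟩
  have hc0 : c ≠ 0 := by rw [hc]; exact mul_ne_zero (by positivity) (Real.exp_ne_zero _)
  have hleft : ∏ n ∈ Finset.range (2 * N), (1 - Real.exp (-(2 * K * n)) * Real.exp (x + 2 * K * N)) =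
      c * ((∏ n ∈ Finset.range N, (1 - Real.exp (-(2 * K * n) + x))) *
      ∏ n ∈ Finset.range N, (1 - Real.exp (-(2 * K * (n + 1)) - x))) := by
    have hprod : ∀ M : ℕ, ∏ n ∈ Finset.range M, (-Real.exp (2 * K * (n + 1) + x)) =
        (-1) ^ M * Real.exp (K * (M * (M + 1)) + M * x) := by
      intro M
      induction M with
      | zero => simp
      | succ M ih =>
        rw [Finset.prod_range_succ, ih, pow_succ]
        have : Real.exp (K * (((M + 1 : ℕ) : ℝ) * (((M + 1 : ℕ) : ℝ) + 1)) +
            ((M + 1 : ℕ) : ℝ) * x) =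
            Real.exp (K * (M * (M + 1)) + M * x) * Real.exp (2 * K * (M + 1) + x) := by
          rw [← Real.exp_add]; push_cast; ring_nf
        rw [this]; ring
    rw [hc, ← hprod, two_mul, Finset.prod_range_add, ← Finset.prod_range_reflect]
    have e1 : ∏ j ∈ Finset.range N, (1 - Real.exp (-(2 * K * ((N - 1 - j : ℕ) : ℝ))) *
        Real.exp (x + 2 * K * N)) = (∏ n ∈ Finset.range N, (-Real.exp (2 * K * (n + 1) + x))) *
          ∏ n ∈ Finset.range N, (1 - Real.exp (-(2 * K * (n + 1)) - x)) := by
      rw [← Finset.prod_mul_distrib]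
      refine Finset.prod_congr rfl fun j hj => ?_
      rw [Finset.mem_range] at hj
      have hcast : ((N - 1 - j : ℕ) : ℝ) = N - 1 - j := by
        rw [Nat.cast_sub (by omega), Nat.cast_sub (by omega), Nat.cast_one]
      have h1 : Real.exp (2 * K * (j + 1) + x) * Real.exp (-(2 * K * (j + 1)) - x) = 1 := by
        rw [← Real.exp_add]; simp
      have h2 : Real.exp (-(2 * K * ((N - 1 - j : ℕ) : ℝ))) * Real.exp (x + 2 * K * N) =
          Real.exp (2 * K * (j + 1) + x) := by
        rw [← Real.exp_add, hcast]; ring_nf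
      rw [h2]
      linear_combination -h1
    have e2 : ∏ n ∈ Finset.range N, (1 - Real.exp (-(2 * K * ((N + n : ℕ) : ℝ))) *
        Real.exp (x + 2 * K * N)) = ∏ n ∈ Finset.range N, (1 - Real.exp (-(2 * K * n) + x)) := by
      refine Finset.prod_congr rfl fun n _ => ?_
      rw [← Real.exp_add]; push_cast; ring_nf
    rw [e1, e2]; ring
  have hright : ∑ k ∈ Finset.range (2 * N + 1), (-1) ^ k * Real.exp (-(K * (k * (k - 1)))) *
      Real.exp (x + 2 * K * N) ^ k * (poch K (2 * N) / (poch K k * poch K (2 * N - k))) =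
      c * ∑ k ∈ Finset.range (2 * N + 1), thetaTerm K x ((k : ℤ) - N) *
        (poch K (2 * N) / (poch K k * poch K (2 * N - k))) := by
    rw [Finset.mul_sum]
    refine Finset.sum_congr rfl fun k _ => ?_
    rw [← mul_assoc c]
    congr 1
    have hsign : (-1 : ℝ) ^ k = (-1) ^ N * (-1 : ℝ) ^ ((k : ℤ) - N) := by
      rw [← zpow_natCast (-1 : ℝ) N, ← zpow_add₀ (by norm_num), ← zpow_natCast]
      congr 1; ring
    rw [hc, thetaTerm, hsign]
    have : Real.exp (-(K * (k * (k - 1)))) * Real.exp (x + 2 * K * N) ^ k =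
        Real.exp (K * (N * (N + 1)) + N * x) * (Real.exp (-(K * ((((k : ℤ) - N : ℤ) : ℝ) *
          ((((k : ℤ) - N : ℤ) : ℝ) - 1)))) * Real.exp ((((k : ℤ) - N : ℤ) : ℝ) * x)) := by
      rw [← Real.exp_nat_mul, ← Real.exp_add, ← Real.exp_add, ← Real.exp_add]
      push_cast; ring_nf
    linear_combination (-1) ^ N * (-1 : ℝ) ^ ((k : ℤ) - N) * this
  rw [hleft, hright] at hg
  rw [hsum]
  exact mul_left_cancel₀ hc0 hg

/-- The Jacobi triple product. -/
theorem tendsto_triple_product (hK : 0 < K) (x : ℝ) :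
    Tendsto (fun N => (∏ n ∈ Finset.range N, (1 - Real.exp (-(2 * K * n) + x))) *
      ∏ n ∈ Finset.range N, (1 - Real.exp (-(2 * K * (n + 1)) - x))) atTop
      (𝓝 (thetaSeries K x / pochInf K)) := by
  obtain ⟨hP, hP0⟩ := tendsto_poch hK
  have hT := tendsto_tsum_of_dominated_convergence (𝓕 := atTop) (f := truncTerm K x)
    (g := fun j => thetaTerm K x j / pochInf K)
    (bound := fun j => ‖thetaTerm K x j‖ * (pochInf K)⁻¹)
    ((summable_thetaTerm hK x).norm.mul_right _) (fun j => ?_) (.of_forall fun N j => ?_)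
  · rw [tsum_div_const] at hT
    exact hT.congr fun N => (finite_triple_product hK x N).symm
  · have h1 : Tendsto (fun N : ℕ => poch K (2 * N)) atTop (𝓝 (pochInf K)) :=
      hP.comp (tendsto_id.const_mul_atTop' two_pos)
    have h2 : Tendsto (fun N : ℕ => poch K (N + j).toNat) atTop (𝓝 (pochInf K)) := by
      refine hP.comp (tendsto_atTop.2 fun b => ?_)
      filter_upwards [eventually_ge_atTop (b + j.natAbs)] with N hN
      omega
    have h3 : Tendsto (fun N : ℕ => poch K (N - j).toNat) atTop (𝓝 (pochInf K)) := by
      refine hP.comp (tendsto_atTop.2 fun b => ?_)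
      filter_upwards [eventually_ge_atTop (b + j.natAbs)] with N hN
      omega
    have h4 := (h1.div (h2.mul h3) (mul_ne_zero hP0.ne' hP0.ne')).const_mul (thetaTerm K x j)
    have h5 : thetaTerm K x j * (pochInf K / (pochInf K * pochInf K)) =
        thetaTerm K x j / pochInf K := by field_simp
    rw [h5] at h4
    refine h4.congr' ?_
    filter_upwards [eventually_ge_atTop j.natAbs] with N hN
    rw [truncTerm, if_pos (by omega)]
    rfl
  · rw [truncTerm]
    split_ifs with h
    · rw [norm_mul]
      refine mul_le_mul_of_nonneg_left ?_ (norm_nonneg _)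
      have p1 := poch_pos hK (2 * N)
      have p2 := poch_pos hK (N + j).toNat
      have p3 := poch_pos hK (N - j).toNat
      rw [Real.norm_eq_abs, abs_of_pos (by positivity), ← div_div, inv_eq_one_div]
      refine div_le_div₀ zero_le_one ((div_le_one p2).2 (poch_antitone hK (by omega))) hP0
        (pochInf_le hK _)
    · rw [norm_zero]; positivity

/-- The logarithms of the factors of the product sum to `-logT`, by expanding each `log (1 - y)` and
interchanging the two summations. -/
theorem hasSum_log_factor (hK : 0 < K) (hx : |x| < 2 * K) :
    HasSum (fun n : ℕ => Real.log ((1 - Real.exp (-(2 * K * (n + 1)) + x)) *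
      (1 - Real.exp (-(2 * K * (n + 1)) - x)) / (1 - Real.exp (-(2 * K * (n + 1)))) ^ 2))
      (-logT x K) := by
  set g : ℕ × ℕ → ℝ := fun p =>
    C x ((p.1 + 1 : ℕ) : ℝ) / ((p.1 + 1 : ℕ) : ℝ) *
      Real.exp (-(((p.2 + 1 : ℕ) : ℝ) * (2 * K * ((p.1 + 1 : ℕ) : ℝ)))) with hg
  have hg0 : ∀ p, 0 ≤ g p := fun p =>
    mul_nonneg (div_nonneg (C_nonneg _ _) (Nat.cast_nonneg _)) (Real.exp_pos _).le
  have hrow : ∀ m : ℕ, HasSum (fun n => g (m, n))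
      (C x ((m + 1 : ℕ) : ℝ) / ((m + 1 : ℕ) : ℝ) * v K (m + 1)) := fun m =>
    (hasSum_exp_succ (d := 2 * K * ((m + 1 : ℕ) : ℝ)) (by positivity)).mul_left _
  have hT := summable_logT hK hx
  have hgs : Summable g := by
    refine (summable_prod_of_nonneg hg0).2 ⟨fun m => (hrow m).summable, ?_⟩
    refine ((summable_nat_add_iff 1).2 hT).congr fun m => ?_
    exact ((hrow m).tsum_eq).symm
  have hsum : HasSum g (logT x K) := by
    have h1 : ∑' p, g p = logT x K := by
      rw [hgs.tsum_prod, tsum_congr fun m => (hrow m).tsum_eq, logT,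
        tsum_eq_tsum_succ (a := fun m : ℕ => C x m / m * v K m) (by simp)]
    exact h1 ▸ hgs.hasSum
  have hswap : HasSum (fun p : ℕ × ℕ => g p.swap) (logT x K) :=
    (Equiv.prodComm ℕ ℕ).hasSum_iff.2 hsum
  refine (hswap.prod_fiberwise fun n => ?_).neg.congr_fun (fun n => (neg_neg _).symm)
  set q := Real.exp (-(2 * K * ((n : ℝ) + 1))) with hq
  have hn : (0 : ℝ) ≤ n := Nat.cast_nonneg n
  have hq1 : q < 1 := by
    rw [hq]; exact Real.exp_lt_one_iff.2 (by nlinarith)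
  have hx' := abs_lt.1 hx
  have ha1 : Real.exp (-(2 * K * ((n : ℝ) + 1)) + x) < 1 :=
    Real.exp_lt_one_iff.2 (by nlinarith)
  have hb1 : Real.exp (-(2 * K * ((n : ℝ) + 1)) - x) < 1 :=
    Real.exp_lt_one_iff.2 (by nlinarith)
  have hq0 : 0 < q := Real.exp_pos _
  have ha0 := Real.exp_pos (-(2 * K * ((n : ℝ) + 1)) + x)
  have hb0 := Real.exp_pos (-(2 * K * ((n : ℝ) + 1)) - x)
  have s1 := Real.hasSum_pow_div_log_of_abs_lt_one (abs_lt.2 ⟨by linarith, ha1⟩)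
  have s2 := Real.hasSum_pow_div_log_of_abs_lt_one (abs_lt.2 ⟨by linarith, hb1⟩)
  have s3 := Real.hasSum_pow_div_log_of_abs_lt_one (x := q) (abs_lt.2 ⟨by linarith, hq1⟩)
  have s := (s1.add s2).sub (s3.mul_left 2)
  rw [Real.log_div (mul_ne_zero (by linarith) (by linarith)) (pow_ne_zero 2 (by linarith)),
    Real.log_mul (by linarith) (by linarith), Real.log_pow]
  convert! s using 1
  · funext m
    simp only [hg, Prod.swap, C, hq]
    rw [← Real.exp_nat_mul, ← Real.exp_nat_mul, ← Real.exp_nat_mul]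
    have e1 : Real.exp (((m + 1 : ℕ) : ℝ) * (-(2 * K * ((n : ℝ) + 1)) + x)) =
        Real.exp (-(((n + 1 : ℕ) : ℝ) * (2 * K * ((m + 1 : ℕ) : ℝ)))) *
          Real.exp (((m + 1 : ℕ) : ℝ) * x) := by
      rw [← Real.exp_add]; push_cast; ring_nf
    have e2 : Real.exp (((m + 1 : ℕ) : ℝ) * (-(2 * K * ((n : ℝ) + 1)) - x)) =
        Real.exp (-(((n + 1 : ℕ) : ℝ) * (2 * K * ((m + 1 : ℕ) : ℝ)))) *
          Real.exp (-(((m + 1 : ℕ) : ℝ) * x)) := by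
      rw [← Real.exp_add]; push_cast; ring_nf
    have e3 : Real.exp (((m + 1 : ℕ) : ℝ) * (-(2 * K * ((n : ℝ) + 1)))) =
        Real.exp (-(((n + 1 : ℕ) : ℝ) * (2 * K * ((m + 1 : ℕ) : ℝ)))) := by
      push_cast; ring_nf
    rw [e1, e2, e3]
    push_cast
    field_simp
  · push_cast; ring

/-- The theta series as an exponential, where no factor of the product other than `1 - e^x` can
vanish. -/
theorem thetaSeries_eq_exp (hK : 0 < K) (hx : |x| < 2 * K) :
    thetaSeries K x = pochInf K ^ 3 * ((1 - Real.exp x) * Real.exp (-logT x K)) := by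
  obtain ⟨hP, hP0⟩ := tendsto_poch hK
  -- shifted by one so that the factor `1 - e^x` splits off and the others pair up
  have h1 := (tendsto_triple_product hK x).comp (tendsto_add_atTop_nat 1)
  have hx' := abs_lt.1 hx
  have hpos : ∀ n : ℕ, 0 < (1 - Real.exp (-(2 * K * (n + 1)) + x)) *
      (1 - Real.exp (-(2 * K * (n + 1)) - x)) / (1 - Real.exp (-(2 * K * (n + 1)))) ^ 2 := by
    intro n
    have hn : (0 : ℝ) ≤ n := Nat.cast_nonneg n
    have a1 : Real.exp (-(2 * K * ((n : ℝ) + 1)) + x) < 1 :=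
      Real.exp_lt_one_iff.2 (by nlinarith)
    have a2 : Real.exp (-(2 * K * ((n : ℝ) + 1)) - x) < 1 :=
      Real.exp_lt_one_iff.2 (by nlinarith)
    have a3 := one_sub_exp_pos hK n
    exact div_pos (mul_pos (by linarith) (by linarith)) (by positivity)
  have h2 := (Real.hasProd_of_hasSum_log hpos (hasSum_log_factor hK hx)).tendsto_prod_nat
  have h3 : Tendsto (fun N : ℕ => 1 - Real.exp (-(2 * K * (N + 1)) - x)) atTop (𝓝 1) := by
    have : Tendsto (fun N : ℕ => Real.exp (-(2 * K * (N + 1)) - x)) atTop (𝓝 0) := by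
      refine Real.tendsto_exp_atBot.comp ?_
      have : Tendsto (fun N : ℕ => 2 * K * ((N : ℝ) + 1)) atTop atTop :=
        (tendsto_atTop_add_const_right _ 1 tendsto_natCast_atTop_atTop).const_mul_atTop
          (by linarith)
      exact tendsto_atBot_add_const_right _ (-x) (tendsto_neg_atTop_atBot.comp this)
    simpa using this.const_sub 1
  have h4 := (((h2.mul (hP.pow 2)).const_mul (1 - Real.exp x))).mul h3
  have h5 := tendsto_nhds_unique h1 (h4.congr fun N => ?_)
  · field_simp at h5
    rw [h5]; ring
  · rw [Finset.prod_div_distrib, Finset.prod_mul_distrib, Finset.prod_pow]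
    change _ * (_ / poch K N ^ 2 * poch K N ^ 2) * _ = _
    rw [div_mul_cancel₀ _ (pow_ne_zero 2 (poch_pos hK N).ne')]
    simp only [Function.comp]
    rw [Finset.prod_range_succ' (fun n : ℕ => 1 - Real.exp (-(2 * K * n) + x)),
      Finset.prod_range_succ (fun n : ℕ => 1 - Real.exp (-(2 * K * (n + 1)) - x))]
    push_cast
    rw [show -(2 * K * (0 : ℝ)) + x = x by ring]
    ring

end

/-! ### `U` as an infinite product -/

section

variable {K x η : ℝ}

/-- The modular transformation of `theta11` at the purely imaginary parameter `iπ/K`. -/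
theorem theta11_eq (hK : 0 < K) (t : ℝ) :
    theta11 t (Complex.I * Real.pi / K) =
      1 / (-Complex.I * (Complex.I * Real.pi / K)) ^ (1 / 2 : ℂ) *
        ((Real.exp (-K / 4) * (Real.exp (-(K * t ^ 2) - K * t) *
          thetaSeries K (2 * K * t)) : ℝ) : ℂ) := by
  have hpi : (Real.pi : ℂ) ≠ 0 := by exact_mod_cast Real.pi_ne_zero
  have hKc : (K : ℂ) ≠ 0 := by exact_mod_cast hK.ne'
  have hI := Complex.I_ne_zero
  have e1 : ((t : ℂ) + (1 + Complex.I * Real.pi / K) / 2) / (Complex.I * Real.pi / K) =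
      -(Complex.I * ((2 * K * t : ℝ) + K)) / (2 * Real.pi) + 1 / 2 := by
    push_cast
    field_simp
    linear_combination ((2 * K * t + K : ℂ)) * Complex.I_sq
  have e2 : -1 / (Complex.I * Real.pi / K) = Complex.I * K / Real.pi := by
    field_simp
    linear_combination -Complex.I_sq
  have e3 : Complex.I * Complex.exp (Real.pi * Complex.I * (t + Complex.I * Real.pi / K / 4)) *
      Complex.exp (-Real.pi * Complex.I * ((t : ℂ) + (1 + Complex.I * Real.pi / K) / 2) ^ 2 /
        (Complex.I * Real.pi / K)) =
      Complex.exp (-K / 4) * Complex.exp (-(K * t ^ 2) - K * t) := by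
    have h1 : Complex.I = Complex.exp (Real.pi / 2 * Complex.I) := Complex.exp_pi_div_two_mul_I.symm
    nth_rewrite 1 [h1]
    rw [← Complex.exp_add, ← Complex.exp_add, ← Complex.exp_add]
    congr 1
    field_simp
    ring
  rw [theta11, jacobiTheta₂_functional_equation, e1, e2, thetaSeries_eq hK]
  push_cast
  linear_combination (1 / (-Complex.I * (Complex.I * Real.pi / K)) ^ (1 / 2 : ℂ) *
    (thetaSeries K (2 * K * t) : ℂ)) * e3

/-- The simple zero of the theta series at the origin. Its derivative is read off the product, so
no termwise differentiation is needed. -/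
theorem hasDerivAt_thetaSeries_zero (hK : 0 < K) :
    HasDerivAt (thetaSeries K) (-pochInf K ^ 3) 0 := by
  have hlog : Tendsto (fun x => logT x K) (𝓝[≠] 0) (𝓝 0) :=
    tendsto_logT_zero hK (tendsto_id.mono_left nhdsWithin_le_nhds) (.of_forall fun _ => le_rfl)
  have h1 := (hasDerivAt_iff_tendsto_slope.1 (Real.hasDerivAt_exp 0))
  have h2 := ((h1.mul ((Real.continuous_exp.tendsto _).comp hlog.neg)).const_mul (-pochInf K ^ 3))
  simp only [neg_zero, Real.exp_zero, mul_one] at h2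
  rw [hasDerivAt_iff_tendsto_slope]
  refine h2.congr' ?_
  have hsmall : ∀ᶠ x : ℝ in 𝓝[≠] 0, |x| < 2 * K := by
    have : Tendsto (fun x : ℝ => |x|) (𝓝[≠] 0) (𝓝 0) := by
      simpa using (continuous_abs.tendsto (0 : ℝ)).mono_left nhdsWithin_le_nhds
    exact this.eventually_lt_const (by linarith)
  filter_upwards [hsmall] with x hx
  have h0 : thetaSeries K 0 = 0 := by
    rw [thetaSeries_eq_exp hK (by simpa using hK)]; simp
  simp only [slope_def_field, Function.comp, h0, thetaSeries_eq_exp hK hx, Real.exp_zero]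
  ring

/-- The complex derivative at `0` is found by restricting to the real line. -/
theorem deriv_theta11 (hK : 0 < K) :
    deriv (fun z : ℂ => theta11 z (Complex.I * Real.pi / K)) 0 =
      1 / (-Complex.I * (Complex.I * Real.pi / K)) ^ (1 / 2 : ℂ) *
        ((Real.exp (-K / 4) * (-(2 * K) * pochInf K ^ 3) : ℝ) : ℂ) := by
  have him : 0 < (Complex.I * Real.pi / K).im := by
    have : Complex.I * Real.pi / K = ((Real.pi / K : ℝ) : ℂ) * Complex.I := by push_cast; ring
    rw [this]
    simpa using div_pos Real.pi_pos hK
  have hd : DifferentiableAt ℂ (fun z : ℂ => theta11 z (Complex.I * Real.pi / K)) 0 := by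
    have hj : ∀ w, DifferentiableAt ℂ (fun z => jacobiTheta₂ z (Complex.I * Real.pi / K)) w :=
      fun w => differentiableAt_jacobiTheta₂_fst w him
    have hj' : DifferentiableAt ℂ (fun z => jacobiTheta₂ (z + (1 + Complex.I * Real.pi / K) / 2)
        (Complex.I * Real.pi / K)) 0 :=
      (hj _).comp (0 : ℂ) (differentiableAt_id.add_const _)
    unfold theta11
    exact DifferentiableAt.mul (by fun_prop) hj'
  have h1 : HasDerivAt (fun t : ℝ => theta11 t (Complex.I * Real.pi / K))
      (deriv (fun z : ℂ => theta11 z (Complex.I * Real.pi / K)) 0) 0 := by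
    have := hd.hasDerivAt
    rw [← Complex.ofReal_zero] at this
    simpa using this.comp_ofReal
  have hz : thetaSeries K (2 * K * 0) = 0 := by
    rw [mul_zero, thetaSeries_eq_exp hK (by simpa using hK)]; simp
  have h2 : HasDerivAt (fun t : ℝ => Real.exp (-(K * t ^ 2) - K * t) * thetaSeries K (2 * K * t))
      (-(2 * K) * pochInf K ^ 3) 0 := by
    have ha : HasDerivAt (fun t : ℝ => Real.exp (-(K * t ^ 2) - K * t))
        (deriv (fun t : ℝ => Real.exp (-(K * t ^ 2) - K * t)) 0) 0 :=
      DifferentiableAt.hasDerivAt (by fun_prop)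
    have hb : HasDerivAt (fun t : ℝ => thetaSeries K (2 * K * t)) (-pochInf K ^ 3 * (2 * K)) 0 := by
      have hc : HasDerivAt (fun t : ℝ => 2 * K * t) (2 * K) 0 := by
        simpa using (hasDerivAt_id (0 : ℝ)).const_mul (2 * K)
      have := hasDerivAt_thetaSeries_zero hK
      rw [← mul_zero (2 * K)] at this
      exact this.comp (0 : ℝ) hc
    refine (ha.mul hb).congr_deriv ?_
    rw [hz]
    simp
    ring
  have h3 := ((h2.const_mul (Real.exp (-K / 4))).ofReal_comp).const_mul
    (1 / (-Complex.I * (Complex.I * Real.pi / K)) ^ (1 / 2 : ℂ))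
  exact h1.unique (h3.congr_of_eventuallyEq (.of_forall fun t => theta11_eq hK t))

theorem complexU_eq (hK : 0 < K) :
    complexU η K = ((-Real.exp (-η) * thetaSeries K η / pochInf K ^ 3 : ℝ) : ℂ) := by
  have hP := (tendsto_poch hK).2
  have hKc : (K : ℂ) ≠ 0 := by exact_mod_cast hK.ne'
  have hpi : (Real.pi : ℂ) ≠ 0 := by exact_mod_cast Real.pi_ne_zero
  have hroot : 1 / (-Complex.I * (Complex.I * Real.pi / K)) ^ (1 / 2 : ℂ) ≠ 0 := by
    refine one_div_ne_zero fun h => ?_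
    rw [Complex.cpow_eq_zero_iff] at h
    exact (mul_ne_zero (neg_ne_zero.2 Complex.I_ne_zero)
      (div_ne_zero (mul_ne_zero Complex.I_ne_zero hpi) hKc)) h.1
  have hc : (η : ℂ) / (2 * K) = ((η / (2 * K) : ℝ) : ℂ) := by push_cast; rfl
  have he : (2 : ℂ) * K * Complex.exp ((η / 2) * (η / (2 * K) - 1)) =
      ((2 * K * Real.exp ((η / 2) * (η / (2 * K) - 1)) : ℝ) : ℂ) := by push_cast; rfl
  rw [complexU, he, hc, theta11_eq hK, deriv_theta11 hK, mul_div_mul_left _ _ hroot,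
    ← Complex.ofReal_div, ← Complex.ofReal_mul]
  congr 1
  have h1 : Real.exp (-η) = Real.exp ((η / 2) * (η / (2 * K) - 1)) *
      Real.exp (-(K * (η / (2 * K)) ^ 2) - K * (η / (2 * K))) := by
    rw [← Real.exp_add]
    congr 1
    field_simp
    ring
  have h2 : 2 * K * (η / (2 * K)) = η := by field_simp
  rw [h1, h2]
  have := Real.exp_pos (-K / 4)
  field_simp

theorem complexU_eq_ofReal (hK : 0 < K) : complexU η K = (U η K : ℂ) := by
  rw [U, complexU_eq hK, Complex.ofReal_re]

theorem U_eq_thetaSeries (hK : 0 < K) :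
    U η K = -Real.exp (-η) * thetaSeries K η / pochInf K ^ 3 := by
  rw [U, complexU_eq hK, Complex.ofReal_re]

theorem U_eq (hη : 0 < η) (hK : η / 2 < K) :
    U η K = (1 - Real.exp (-η)) * Real.exp (-logT η K) := by
  have hK0 : 0 < K := by linarith
  have hP := (tendsto_poch hK0).2
  rw [U_eq_thetaSeries hK0, thetaSeries_eq_exp hK0 (by rw [abs_of_pos hη]; linarith)]
  have : Real.exp (-η) * Real.exp η = 1 := by rw [← Real.exp_add]; simp
  field_simp
  linear_combination this

/-- A second expression of `U`, from the quasi-periodicity of the theta series; it exhibits the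
zero at `K = η / 2`. -/
theorem U_eq_reflected (hη : 0 < η) (hK : η / 2 ≤ K) :
    U η K = (1 - Real.exp (-(2 * K - η))) * Real.exp (-logT (2 * K - η) K) := by
  have hK0 : 0 < K := by linarith
  have hP := (tendsto_poch hK0).2
  have h := thetaSeries_eq_exp (K := K) (x := η - 2 * K) hK0
    (by rw [abs_lt]; constructor <;> linarith)
  rw [U_eq_thetaSeries hK0, ← thetaSeries_sub, h, ← logT_neg, neg_sub, neg_sub]
  field_simp

end

/-! ### Summation of Weierstrass functions by rows -/

section

open Complex in
/-- `halfCoth z = ½ coth (z / 2)`, with value `0` at the multiples of `2πi`. -/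
def halfCoth (z : ℂ) : ℂ := (exp z + 1) / (2 * (exp z - 1))

/-- The sum of `1 / l ^ 2` over the row `z + 2πi ℤ`, omitting `l = 0`. -/
def rowSq (z : ℂ) : ℂ := ∑' m : ℤ, 1 / (z + m * (2 * Real.pi * Complex.I)) ^ 2

theorem halfCoth_neg (z : ℂ) : halfCoth (-z) = -halfCoth z := by
  have h := Complex.exp_ne_zero z
  rw [halfCoth, halfCoth, Complex.exp_neg]
  by_cases h1 : Complex.exp z - 1 = 0
  · have : Complex.exp z = 1 := by linear_combination h1
    simp [this]
  have h2 : (Complex.exp z)⁻¹ - 1 = -(Complex.exp z - 1) / Complex.exp z := by field_simp; ring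
  have h3 : (Complex.exp z)⁻¹ + 1 = (Complex.exp z + 1) / Complex.exp z := by field_simp; ring
  rw [h2, h3]
  field_simp

/-- The Mittag-Leffler expansion of `halfCoth`. The point `z = 0` is covered by junk values. -/
theorem hasSum_halfCoth {z : ℂ} (hz : z = 0 ∨ Complex.exp z ≠ 1) :
    HasSum (fun m : ℕ => 1 / (z - (m + 1) * (2 * Real.pi * Complex.I)) +
      1 / (z + (m + 1) * (2 * Real.pi * Complex.I))) (halfCoth z - 1 / z) := by
  have hp := Complex.two_pi_I_ne_zero
  rcases hz with rfl | hz
  · have : halfCoth 0 = 0 := by simp [halfCoth]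
    simp [this, div_neg]
  set x := z / (2 * Real.pi * Complex.I) with hx
  have hxz : x * (2 * Real.pi * Complex.I) = z := div_mul_cancel₀ _ hp
  have hx0 : x ∈ Complex.integerComplement := by
    rintro ⟨n, hn⟩
    apply hz
    rw [← hxz, ← hn]
    exact Complex.exp_int_mul_two_pi_mul_I n
  have h1 := (Summable.hasSum (summable_cotTerm hx0))
  have h2 : (∑' n, cotTerm x n) = _ := (cot_series_rep' hx0).symm
  rw [h2] at h1
  have h3 := h1.mul_left (1 / (2 * Real.pi * Complex.I))
  convert! h3 using 1
  · funext m
    rw [cotTerm, ← hxz, mul_add, one_div_mul_one_div, one_div_mul_one_div]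
    congr 2 <;> ring
  · have hxe : 2 * Real.pi * Complex.I * x = z := by rw [mul_comm]; exact hxz
    have hx' : x ≠ 0 := Complex.integerComplement.ne_zero hx0
    rw [Complex.cot_pi_eq_exp_ratio, hxe, halfCoth]
    have hz1 : Complex.exp z - 1 ≠ 0 := sub_ne_zero.2 hz
    have hz2 : 1 - Complex.exp z ≠ 0 := sub_ne_zero.2 (Ne.symm hz)
    have hpi : (Real.pi : ℂ) ≠ 0 := by exact_mod_cast Real.pi_ne_zero
    have hI := Complex.I_ne_zero
    rw [mul_sub (1 / (2 * Real.pi * Complex.I : ℂ))]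
    congr 1
    · rw [div_eq_iff (mul_ne_zero two_ne_zero hz1)]
      field_simp
      linear_combination (-(Complex.exp z + 1) * (Complex.exp z - 1)) * Complex.I_sq
    · rw [one_div_mul_one_div, mul_comm, hxz]

theorem summable_rowSq (z : ℂ) :
    Summable fun m : ℤ => 1 / (z + m * (2 * Real.pi * Complex.I)) ^ 2 := by
  have hp := Complex.two_pi_I_ne_zero
  have h := (EisensteinSeries.linear_right_summable (z / (2 * Real.pi * Complex.I)) 1
    (k := 2) le_rfl).mul_left (1 / (2 * Real.pi * Complex.I) ^ 2)
  refine h.congr fun m => ?_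
  have : z + m * (2 * Real.pi * Complex.I) =
      (2 * Real.pi * Complex.I) * ((1 : ℤ) * (z / (2 * Real.pi * Complex.I)) + m) := by
    field_simp
    push_cast
    ring
  rw [this, zpow_ofNat, one_div, one_div, ← mul_inv, ← mul_pow]

theorem rowSq_neg (z : ℂ) : rowSq (-z) = rowSq z := by
  rw [rowSq, rowSq, ← (Equiv.neg ℤ).tsum_eq]
  refine tsum_congr fun m => ?_
  simp only [Equiv.neg_apply]
  push_cast
  rw [← neg_sq]
  congr 2
  ring

theorem rowSq_sub (z : ℂ) :
    ∑' m : ℤ, 1 / (z - m * (2 * Real.pi * Complex.I)) ^ 2 = rowSq z := by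
  rw [rowSq, ← (Equiv.neg ℤ).tsum_eq]
  refine tsum_congr fun m => ?_
  simp [sub_eq_add_neg]

/-- The Lipschitz formula for a row at real distance `x` from the origin. -/
theorem rowSq_ofReal {x : ℝ} (hx : 0 < x) :
    rowSq x = ((Real.exp (-x) / (1 - Real.exp (-x)) ^ 2 : ℝ) : ℂ) := by
  have hp := Complex.two_pi_I_ne_zero
  have hpi : (Real.pi : ℂ) ≠ 0 := by exact_mod_cast Real.pi_ne_zero
  have him : 0 < ((-(x : ℂ)) / (2 * Real.pi * Complex.I)).im := by
    have : (-(x : ℂ)) / (2 * Real.pi * Complex.I) = ((x / (2 * Real.pi) : ℝ) : ℂ) * Complex.I := by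
      have := Complex.I_ne_zero
      push_cast
      field_simp
      linear_combination -(x : ℂ) * Complex.I_sq
    rw [this, Complex.mul_I_im, Complex.ofReal_re]
    positivity
  have h := EisensteinSeries.qExpansion_identity (k := 1) le_rfl
    ⟨(-(x : ℂ)) / (2 * Real.pi * Complex.I), him⟩
  simp only [pow_one, Nat.factorial_one, Nat.cast_one, div_one,
    mul_div_cancel₀ _ hp] at h
  have hn : ‖Complex.exp (-(x : ℂ))‖ < 1 := by
    rw [← Complex.ofReal_neg, Complex.norm_exp_ofReal]
    exact Real.exp_lt_one_iff.2 (by linarith)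
  rw [tsum_coe_mul_geometric_of_norm_lt_one hn] at h
  have h2 : rowSq (-(x : ℂ)) = 1 / (2 * Real.pi * Complex.I) ^ 2 *
      ∑' n : ℤ, 1 / ((-(x : ℂ)) / (2 * Real.pi * Complex.I) + n) ^ (1 + 1) := by
    rw [rowSq, ← tsum_mul_left]
    refine tsum_congr fun m => ?_
    rw [one_div_mul_one_div, ← mul_pow]
    congr 2
    field_simp
  rw [← rowSq_neg, h2, h]
  push_cast
  field_simp

theorem rowSq_zero : rowSq 0 = -(1 / 12) := by
  have hpi : (Real.pi : ℂ) ≠ 0 := by exact_mod_cast Real.pi_ne_zero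
  have h := two_mul_riemannZeta_eq_tsum_int_inv_pow_of_even (k := 2) le_rfl even_two
  have h2 : rowSq 0 = 1 / (2 * Real.pi * Complex.I) ^ 2 * ∑' n : ℤ, 1 / (n : ℂ) ^ 2 := by
    rw [rowSq, ← tsum_mul_left]
    refine tsum_congr fun m => ?_
    rw [zero_add, mul_pow, one_div_mul_one_div, mul_comm]
  simp only [one_div] at h2
  push_cast at h
  rw [riemannZeta_two] at h
  rw [h2, ← h, mul_pow, Complex.I_sq]
  field_simp
  norm_num

/-- The sum of a summable family over `ℤ` in symmetric pairs. -/
theorem hasSum_int_pairs {f : ℤ → ℂ} (hf : Summable f) :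
    HasSum (fun n : ℕ => f ((n : ℤ) + 1) + f (-((n : ℤ) + 1))) (∑' m, f m - f 0) := by
  have h := (hasSum_nat_add_iff' 1).2 hf.hasSum.nat_add_neg
  simp only [Finset.sum_range_one, Nat.cast_zero, neg_zero] at h
  convert! h using 1
  ring

variable {K : ℝ}

theorem lattice_point (hK : 0 < K) (p : ℤ × ℤ) :
    (((rectPeriods K hK).latticeEquivProd.symm p : (rectPeriods K hK).lattice) : ℂ) =
      p.1 * (2 * K) + p.2 * (2 * Real.pi * Complex.I) := by
  rw [PeriodPair.latticeEquiv_symm_apply]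
  rfl

theorem weierstrassZeta_term_bound (r : ℝ) (s : ℂ) (hs : ‖s‖ < r) (l : ℂ)
    (h : 2 * r ≤ ‖l‖) :
    ‖1 / (s - l) + 1 / l + s / l ^ 2‖ ≤ 2 * r ^ 2 * ‖l‖ ^ (-3 : ℝ) := by
  have hr : 0 < r := (norm_nonneg s).trans_lt hs
  have hl : 0 < ‖l‖ := by linarith
  have hl0 : l ≠ 0 := norm_pos_iff.1 hl
  have hsl : ‖l‖ / 2 ≤ ‖s - l‖ := by
    rw [norm_sub_rev]
    exact le_trans (by linarith) (norm_sub_norm_le l s)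
  have hsl0 : s - l ≠ 0 := norm_pos_iff.1 (by linarith)
  have e : 1 / (s - l) + 1 / l + s / l ^ 2 = s ^ 2 / (l ^ 2 * (s - l)) := by field_simp; ring
  rw [e, norm_div, norm_mul, norm_pow, norm_pow]
  calc ‖s‖ ^ 2 / (‖l‖ ^ 2 * ‖s - l‖) ≤ r ^ 2 / (‖l‖ ^ 2 * (‖l‖ / 2)) := by gcongr
    _ = 2 * r ^ 2 / ‖l‖ ^ 3 := by field_simp
    _ = _ := by
      rw [Real.rpow_neg hl.le]
      norm_cast

theorem hasSum_weierstrassZeta (L : PeriodPair) (z : ℂ) :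
    HasSum (fun l : L.lattice => 1 / (z - l) + 1 / (l : ℂ) + z / (l : ℂ) ^ 2)
      (weierstrassZeta L z) := by
  refine (L.hasSumLocallyUniformly_aux (u := (2 * · ^ 2 * ‖·‖ ^ (-3 : ℝ)))
    (fun (l : L.lattice) (z : ℂ) => 1 / (z - l) + 1 / (l : ℂ) + z / (l : ℂ) ^ 2)
    (fun _ _ => (ZLattice.summable_norm_rpow _ _ (by simp; norm_num)).mul_left _) fun r hr =>
    Filter.eventually_atTop.mpr ⟨2 * r, ?_⟩).hasSum
  rintro _ h s hs l rfl
  exact weierstrassZeta_term_bound r s hs l h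

/-- One row of the Weierstrass zeta function. -/
theorem tsum_zeta_row {z a : ℂ} (h1 : z - a = 0 ∨ Complex.exp (z - a) ≠ 1)
    (h2 : a = 0 ∨ Complex.exp a ≠ 1)
    (hs : Summable fun m : ℤ => 1 / (z - (a + m * (2 * Real.pi * Complex.I))) +
      1 / (a + m * (2 * Real.pi * Complex.I)) + z / (a + m * (2 * Real.pi * Complex.I)) ^ 2) :
    ∑' m : ℤ, (1 / (z - (a + m * (2 * Real.pi * Complex.I))) +
      1 / (a + m * (2 * Real.pi * Complex.I)) + z / (a + m * (2 * Real.pi * Complex.I)) ^ 2) =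
      halfCoth (z - a) + halfCoth a + z * rowSq a := by
  have hq := (summable_rowSq a).mul_left z
  have hz : ∀ m : ℤ, z / (a + m * (2 * Real.pi * Complex.I)) ^ 2 =
      z * (1 / (a + m * (2 * Real.pi * Complex.I)) ^ 2) := fun m => by rw [mul_one_div]
  -- removing the `z / l²` part leaves a series that still converges absolutely
  have hp : Summable fun m : ℤ => 1 / (z - (a + m * (2 * Real.pi * Complex.I))) +
      1 / (a + m * (2 * Real.pi * Complex.I)) :=
    (hs.sub hq).congr fun m => by rw [hz]; ring
  have h3 := hasSum_int_pairs hp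
  have h4 := (hasSum_halfCoth h1).add (hasSum_halfCoth h2)
  have h5 := h3.unique (h4.congr_fun fun m => ?_)
  · rw [tsum_congr fun m => congrArg _ (hz m), hp.tsum_add hq, tsum_mul_left, rowSq]
    have h6 : ∑' m : ℤ, (1 / (z - (a + m * (2 * Real.pi * Complex.I))) +
      1 / (a + m * (2 * Real.pi * Complex.I))) = halfCoth (z - a) + halfCoth a := by
      simp only [Int.cast_zero, zero_mul, add_zero] at h5
      linear_combination h5
    rw [h6]
  · push_cast
    simp only [sub_eq_add_neg, neg_add, one_div]
    ring

/-- One row of the Weierstrass elliptic function. -/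
theorem tsum_weierstrassP_row (z a : ℂ) :
    ∑' m : ℤ, (1 / (z - (a + m * (2 * Real.pi * Complex.I))) ^ 2 -
      1 / (a + m * (2 * Real.pi * Complex.I)) ^ 2) = rowSq (z - a) - rowSq a := by
  have h1 : Summable fun m : ℤ => 1 / (z - (a + m * (2 * Real.pi * Complex.I))) ^ 2 := by
    refine ((Equiv.neg ℤ).summable_iff.2 (summable_rowSq (z - a))).congr fun m => ?_
    simp only [Function.comp, Equiv.neg_apply]
    push_cast
    congr 2
    ring
  rw [h1.tsum_sub (summable_rowSq a), ← rowSq_sub, rowSq]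
  congr 1
  refine tsum_congr fun m => ?_
  rw [sub_sub]

/-- Summation of the Weierstrass zeta function by rows. -/
theorem hasSum_weierstrassZeta_rows (hK : 0 < K) {z : ℂ}
    (hz : ∀ n : ℤ, Complex.exp (z - n * (2 * K)) ≠ 1) :
    HasSum (fun n : ℕ => halfCoth (z - (n + 1) * (2 * K)) + halfCoth (z + (n + 1) * (2 * K)) +
      2 * z * rowSq ((n + 1) * (2 * K))) (weierstrassZeta (rectPeriods K hK) z -
        (halfCoth z - z / 12)) := by
  have h := (rectPeriods K hK).latticeEquivProd.symm.toEquiv.hasSum_iff.2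
    (hasSum_weierstrassZeta (rectPeriods K hK) z)
  have h' : HasSum (fun p : ℤ × ℤ => 1 / (z - (p.1 * (2 * K) + p.2 * (2 * Real.pi * Complex.I))) +
      1 / (p.1 * (2 * K) + p.2 * (2 * Real.pi * Complex.I)) +
      z / (p.1 * (2 * K) + p.2 * (2 * Real.pi * Complex.I)) ^ 2)
      (weierstrassZeta (rectPeriods K hK) z) := by
    refine h.congr_fun (fun p => ?_)
    simp only [Function.comp, LinearEquiv.coe_toEquiv, lattice_point hK p]
  have hrow : ∀ n : ℤ, ∑' m : ℤ, (1 / (z - (n * (2 * K) + m * (2 * Real.pi * Complex.I))) +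
      1 / (n * (2 * K) + m * (2 * Real.pi * Complex.I)) +
      z / (n * (2 * K) + m * (2 * Real.pi * Complex.I)) ^ 2) =
      halfCoth (z - n * (2 * K)) + halfCoth (n * (2 * K)) + z * rowSq (n * (2 * K)) := by
    intro n
    refine tsum_zeta_row (Or.inr (hz n)) ?_ (h'.summable.prod_factor n)
    rcases eq_or_ne n 0 with rfl | hn
    · left; simp
    · right
      have : ((n : ℂ) * (2 * K)) = ((n * (2 * K) : ℝ) : ℂ) := by push_cast; rfl
      rw [this, ← Complex.ofReal_exp]
      norm_cast
      rw [Real.exp_eq_one_iff]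
      have : (n : ℝ) ≠ 0 := by exact_mod_cast hn
      positivity
  have h2 : Summable fun n : ℤ =>
      halfCoth (z - n * (2 * K)) + halfCoth (n * (2 * K)) + z * rowSq (n * (2 * K)) :=
    h'.summable.prod.congr hrow
  have h3 := hasSum_int_pairs h2
  rw [← tsum_congr hrow, ← h'.summable.tsum_prod, h'.tsum_eq] at h3
  convert! h3 using 1
  · funext n
    push_cast
    rw [neg_mul, halfCoth_neg, rowSq_neg, sub_neg_eq_add]
    ring
  · simp only [Int.cast_zero, zero_mul, sub_zero, rowSq_zero]
    simp [halfCoth]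
    ring

/-- Summation of the Weierstrass elliptic function by rows. -/
theorem hasSum_weierstrassP_rows (hK : 0 < K) (z : ℂ) :
    HasSum (fun n : ℕ => rowSq (z - (n + 1) * (2 * K)) + rowSq (z + (n + 1) * (2 * K)) -
      2 * rowSq ((n + 1) * (2 * K))) ((rectPeriods K hK).weierstrassP z -
        (rowSq z + 1 / 12)) := by
  have h := (rectPeriods K hK).latticeEquivProd.symm.toEquiv.hasSum_iff.2
    ((rectPeriods K hK).hasSum_weierstrassP z)
  have h' : HasSum (fun p : ℤ × ℤ =>
      1 / (z - (p.1 * (2 * K) + p.2 * (2 * Real.pi * Complex.I))) ^ 2 -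
      1 / (p.1 * (2 * K) + p.2 * (2 * Real.pi * Complex.I)) ^ 2)
      ((rectPeriods K hK).weierstrassP z) := by
    refine h.congr_fun (fun p => ?_)
    simp only [Function.comp, LinearEquiv.coe_toEquiv, lattice_point hK p]
  have hrow := fun n : ℤ => tsum_weierstrassP_row z (n * (2 * K))
  have h2 : Summable fun n : ℤ => rowSq (z - n * (2 * K)) - rowSq (n * (2 * K)) :=
    h'.summable.prod.congr hrow
  have h3 := hasSum_int_pairs h2
  rw [← tsum_congr hrow, ← h'.summable.tsum_prod, h'.tsum_eq] at h3
  convert! h3 using 1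
  · funext n
    push_cast
    rw [neg_mul, rowSq_neg, sub_neg_eq_add]
    ring
  · simp only [Int.cast_zero, zero_mul, sub_zero, rowSq_zero]
    ring

end

/-! ### `V` as a logarithmic derivative -/

section

variable {K η : ℝ}

/-- Lambert series: summing `∑ b m * q^{n m}` over `n ≥ 1`. -/
theorem hasSum_lambert (hK : 0 < K) {b : ℕ → ℝ} (hb0 : b 0 = 0)
    (hb : Summable fun m => |b m| * v K m) :
    HasSum (fun n : ℕ => ∑' m : ℕ, b m * Real.exp (-(((n + 1 : ℕ) : ℝ) * (2 * K * m))))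
      (∑' m, b m * v K m) := by
  obtain ⟨g, hg⟩ : ∃ g : ℕ × ℕ → ℝ, ∀ m n, g (m, n) =
      b m * Real.exp (-(((n + 1 : ℕ) : ℝ) * (2 * K * m))) :=
    ⟨fun p => b p.1 * Real.exp (-(((p.2 + 1 : ℕ) : ℝ) * (2 * K * p.1))), fun _ _ => rfl⟩
  have hrow : ∀ c : ℕ → ℝ, c 0 = 0 → ∀ m : ℕ, HasSum (fun n : ℕ => c m *
      Real.exp (-(((n + 1 : ℕ) : ℝ) * (2 * K * m)))) (c m * v K m) := by
    intro c hc m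
    rcases eq_or_ne m 0 with rfl | hm
    · simp [hc]
    · exact (hasSum_exp_succ (d := 2 * K * m) (by positivity)).mul_left (c m)
  have hn : Summable fun p => ‖g p‖ := by
    have e : ∀ m n, ‖g (m, n)‖ = |b m| * Real.exp (-(((n + 1 : ℕ) : ℝ) * (2 * K * m))) :=
      fun m n => by rw [hg, norm_mul, Real.norm_eq_abs, Real.norm_eq_abs, Real.abs_exp]
    have hrow' := hrow (fun m => |b m|) (by simp [hb0])
    refine (summable_prod_of_nonneg fun p => norm_nonneg (g p)).2 ⟨fun m => ?_, ?_⟩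
    · exact (hrow' m).summable.congr fun n => (e m n).symm
    · refine hb.congr fun m => ?_
      rw [← (hrow' m).tsum_eq]
      exact tsum_congr fun n => (e m n).symm
  have hs := hn.of_norm
  have h1 : ∑' p, g p = ∑' m, b m * v K m := by
    rw [hs.tsum_prod]
    refine tsum_congr fun m => ?_
    rw [← (hrow b hb0 m).tsum_eq]
    exact tsum_congr fun n => hg m n
  have hswap : HasSum (fun p : ℕ × ℕ => g p.swap) (∑' m, b m * v K m) := by
    rw [← h1]
    exact (Equiv.prodComm ℕ ℕ).hasSum_iff.2 hs.hasSum
  refine hswap.prod_fiberwise fun n => ?_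
  have h2 := (hswap.summable.prod_factor n).hasSum
  simp only [Prod.swap_prod_mk, hg] at h2 ⊢
  exact h2

theorem exp_neg_lt_one {y : ℝ} (hy : 0 < y) : Real.exp (-y) < 1 :=
  Real.exp_lt_one_iff.2 (by linarith)

/-- `½ coth (y / 2)` in terms of a geometric series. -/
theorem halfCoth_ofReal (y : ℝ) (hy : 0 < y) :
    halfCoth y = ((1 / (1 - Real.exp (-y)) - 1 / 2 : ℝ) : ℂ) := by
  have h1 := exp_neg_lt_one hy
  have h2 : 1 < Real.exp y := Real.one_lt_exp_iff.2 hy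
  have : halfCoth y = (((Real.exp y + 1) / (2 * (Real.exp y - 1)) : ℝ) : ℂ) := by
    rw [halfCoth]; push_cast; rfl
  rw [this]
  congr 1
  rw [Real.exp_neg]
  have h3 : Real.exp y - 1 ≠ 0 := by linarith
  have h4 : 1 - (Real.exp y)⁻¹ = (Real.exp y - 1) / Real.exp y := by field_simp
  rw [h4]
  field_simp
  ring

theorem hasSum_geometric_exp {y : ℝ} (hy : 0 < y) :
    HasSum (fun m : ℕ => Real.exp (-(m * y))) (1 / (1 - Real.exp (-y))) := by
  have h := hasSum_geometric_of_lt_one (Real.exp_pos (-y)).le (exp_neg_lt_one hy)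
  rw [one_div]
  refine h.congr_fun (fun m => ?_)
  rw [← Real.exp_nat_mul, mul_neg]

theorem hasSum_coe_mul_geometric_exp {y : ℝ} (hy : 0 < y) :
    HasSum (fun m : ℕ => m * Real.exp (-(m * y))) (Real.exp (-y) / (1 - Real.exp (-y)) ^ 2) := by
  have h := hasSum_coe_mul_geometric_of_norm_lt_one (r := Real.exp (-y)) (by
    rw [Real.norm_eq_abs, Real.abs_exp]; exact exp_neg_lt_one hy)
  refine h.congr_fun (fun m => ?_)
  rw [← Real.exp_nat_mul, mul_neg]

theorem hasSum_rowSq_real (hK : 0 < K) :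
    HasSum (fun n : ℕ => rowSq ((n + 1) * (2 * K))) ((∑' m : ℕ, m * v K m : ℝ) : ℂ) := by
  have hb : Summable fun m : ℕ => |(m : ℝ)| * v K m := by
    simpa using summable_pow_mul_v hK 1
  have h := Complex.hasSum_ofReal.2 (hasSum_lambert hK (b := fun m => (m : ℝ)) (by simp) hb)
  refine h.congr_fun (fun n => ?_)
  have hy : 0 < ((n + 1 : ℕ) : ℝ) * (2 * K) := by positivity
  have e : ((n : ℂ) + 1) * (2 * K) = ((((n + 1 : ℕ) : ℝ) * (2 * K) : ℝ) : ℂ) := by push_cast; rfl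
  rw [e, rowSq_ofReal hy, ← (hasSum_coe_mul_geometric_exp hy).tsum_eq]
  congr 1
  exact tsum_congr fun m => by ring_nf

theorem hasSum_halfCoth_real (hη : 0 < η) (hK : η < 2 * K) :
    HasSum (fun n : ℕ => halfCoth (η - (n + 1) * (2 * K)) + halfCoth (η + (n + 1) * (2 * K)))
      ((-∑' m : ℕ, v K m * (Real.exp (m * η) - Real.exp (-(m * η))) : ℝ) : ℂ) := by
  have hK0 : 0 < K := by linarith
  have hb : Summable fun m : ℕ => |-(Real.exp (m * η) - Real.exp (-(m * η)))| * v K m := by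
    refine Summable.of_nonneg_of_le (fun m => mul_nonneg (abs_nonneg _) (v_nonneg hK0 m))
      (fun m => ?_) (summable_v_mul_exp (x := η) hK0 (by rwa [abs_of_pos hη]))
    rw [mul_comm, abs_neg, abs_of_pos hη]
    refine mul_le_mul_of_nonneg_left ?_ (v_nonneg hK0 m)
    have h1 : Real.exp (-(m * η)) ≤ Real.exp (m * η) := by
      apply Real.exp_le_exp.2
      have : 0 ≤ m * η := by positivity
      linarith
    rw [abs_of_nonneg (by linarith)]
    linarith [Real.exp_pos (-(m * η))]
  have h := Complex.hasSum_ofReal.2 (hasSum_lambert hK0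
    (b := fun m : ℕ => -(Real.exp (m * η) - Real.exp (-(m * η)))) (by simp) hb)
  have hval : ∑' m : ℕ, -(Real.exp (m * η) - Real.exp (-(m * η))) * v K m =
      -∑' m : ℕ, v K m * (Real.exp (m * η) - Real.exp (-(m * η))) := by
    rw [← tsum_neg]
    exact tsum_congr fun m => by ring
  rw [hval] at h
  refine h.congr_fun (fun n => ?_)
  obtain ⟨a, ha⟩ : ∃ a, a = ((n + 1 : ℕ) : ℝ) * (2 * K) := ⟨_, rfl⟩
  have haK : 2 * K ≤ a := by
    rw [ha]; push_cast; nlinarith [Nat.cast_nonneg (α := ℝ) n]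
  have e1 : (η : ℂ) - ((n : ℂ) + 1) * (2 * K) = -((a - η : ℝ) : ℂ) := by
    rw [ha]; push_cast; ring
  have e2 : (η : ℂ) + ((n : ℂ) + 1) * (2 * K) = ((a + η : ℝ) : ℂ) := by
    rw [ha]; push_cast; ring
  have s1 := hasSum_geometric_exp (y := a - η) (by linarith)
  have s2 := hasSum_geometric_exp (y := a + η) (by linarith)
  rw [e1, e2, halfCoth_neg, halfCoth_ofReal _ (by linarith), halfCoth_ofReal _ (by linarith),
    ← s1.tsum_eq, ← s2.tsum_eq, ← Complex.ofReal_neg, ← Complex.ofReal_add]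
  congr 1
  have hval := (s2.summable.tsum_sub s1.summable).symm
  rw [show (∑' m : ℕ, (Real.exp (-(m * (a + η))) - Real.exp (-(m * (a - η))))) =
      ∑' m : ℕ, -(Real.exp (m * η) - Real.exp (-(m * η))) *
        Real.exp (-(((n + 1 : ℕ) : ℝ) * (2 * K * m))) from tsum_congr fun m => by
      have x1 : Real.exp (-(m * (a - η))) = Real.exp (-(m * a)) * Real.exp (m * η) := by
        rw [← Real.exp_add]; ring_nf
      have x2 : Real.exp (-(m * (a + η))) = Real.exp (-(m * a)) * Real.exp (-(m * η)) := by
        rw [← Real.exp_add]; ring_nf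
      have x3 : -(((n + 1 : ℕ) : ℝ) * (2 * K * m)) = -(m * a) := by rw [ha]; ring
      rw [x1, x2, x3]; ring] at hval
  linarith

theorem hasSum_rowSq_pair_real (hη : 0 < η) (hK : η < 2 * K) :
    HasSum (fun n : ℕ => rowSq (η - (n + 1) * (2 * K)) + rowSq (η + (n + 1) * (2 * K)) -
      2 * rowSq ((n + 1) * (2 * K))) ((∑' m : ℕ, m * (v K m * C η m) : ℝ) : ℂ) := by
  have hK0 : 0 < K := by linarith
  have hb : Summable fun m : ℕ => |m * C η m| * v K m := by
    refine (summable_pow_mul_v_mul_C (x := η) hK0 (by rwa [abs_of_pos hη]) 1).congr fun m => ?_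
    rw [abs_of_nonneg (mul_nonneg (Nat.cast_nonneg m) (C_nonneg η m))]
    ring
  have h := Complex.hasSum_ofReal.2 (hasSum_lambert hK0
    (b := fun m : ℕ => m * C η m) (by simp) hb)
  rw [tsum_congr fun m : ℕ => show m * C η m * v K m = m * (v K m * C η m) by ring] at h
  refine h.congr_fun (fun n => ?_)
  obtain ⟨a, ha⟩ : ∃ a, a = ((n + 1 : ℕ) : ℝ) * (2 * K) := ⟨_, rfl⟩
  have haK : 2 * K ≤ a := by
    rw [ha]; push_cast; nlinarith [Nat.cast_nonneg (α := ℝ) n]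
  have e1 : (η : ℂ) - ((n : ℂ) + 1) * (2 * K) = -((a - η : ℝ) : ℂ) := by
    rw [ha]; push_cast; ring
  have e2 : (η : ℂ) + ((n : ℂ) + 1) * (2 * K) = ((a + η : ℝ) : ℂ) := by
    rw [ha]; push_cast; ring
  have e3 : ((n : ℂ) + 1) * (2 * K) = (a : ℂ) := by
    rw [ha]; push_cast; ring
  have s1 := hasSum_coe_mul_geometric_exp (y := a - η) (by linarith)
  have s2 := hasSum_coe_mul_geometric_exp (y := a + η) (by linarith)
  have s3 := hasSum_coe_mul_geometric_exp (y := a) (by linarith)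
  have s := (s1.add s2).sub (s3.mul_left 2)
  rw [e1, e2, e3, rowSq_neg, rowSq_ofReal (by linarith), rowSq_ofReal (by linarith),
    rowSq_ofReal (by linarith : 0 < a)]
  have hval := s.tsum_eq
  rw [show (∑' m : ℕ, (m * Real.exp (-(m * (a - η))) + m * Real.exp (-(m * (a + η))) -
    2 * (m * Real.exp (-(m * a))))) = ∑' m : ℕ, m * C η m *
      Real.exp (-(((n + 1 : ℕ) : ℝ) * (2 * K * m))) from tsum_congr fun m => by
      have x1 : Real.exp (-(m * (a - η))) = Real.exp (-(m * a)) * Real.exp (m * η) := by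
        rw [← Real.exp_add]; ring_nf
      have x2 : Real.exp (-(m * (a + η))) = Real.exp (-(m * a)) * Real.exp (-(m * η)) := by
        rw [← Real.exp_add]; ring_nf
      have x3 : -(((n + 1 : ℕ) : ℝ) * (2 * K * m)) = -(m * a) := by rw [ha]; ring
      rw [x1, x2, x3, C]; ring] at hval
  rw [hval]
  push_cast
  ring

/-- At the half-period `iπ` the rows `n` and `-n` cancel, apart from the part linear in `z`. -/
theorem weierstrassZeta_pi_mul_I (hK : 0 < K) :
    weierstrassZeta (rectPeriods K hK) (Complex.I * Real.pi) / (Complex.I * Real.pi) =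
      ((-(1 / 12) + 2 * ∑' m : ℕ, m * v K m : ℝ) : ℂ) := by
  have hpi : (Complex.I * Real.pi : ℂ) ≠ 0 :=
    mul_ne_zero Complex.I_ne_zero (by exact_mod_cast Real.pi_ne_zero)
  have hexp : ∀ y : ℝ, Complex.exp (Complex.I * Real.pi + y) = ((-Real.exp y : ℝ) : ℂ) := by
    intro y
    rw [Complex.exp_add, mul_comm Complex.I, Complex.exp_pi_mul_I]
    push_cast; ring
  have h := hasSum_weierstrassZeta_rows hK (z := Complex.I * Real.pi) fun n => by
    have e : Complex.I * Real.pi - n * (2 * K) =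
        Complex.I * Real.pi + ((-(n * (2 * K)) : ℝ) : ℂ) := by push_cast; ring
    rw [e, hexp]
    intro h1
    have h2 : -Real.exp (-(n * (2 * K))) = 1 := by exact_mod_cast h1
    linarith [Real.exp_pos (-(n * (2 * K)))]
  have h1 := (hasSum_rowSq_real hK).mul_left (2 * (Complex.I * Real.pi))
  have h0 : halfCoth (Complex.I * Real.pi) = 0 := by
    rw [halfCoth, mul_comm Complex.I, Complex.exp_pi_mul_I]; simp
  have hpair : ∀ a : ℝ, halfCoth (Complex.I * Real.pi - a) +
      halfCoth (Complex.I * Real.pi + a) = 0 := by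
    intro a
    have h2 := hexp (-a)
    rw [Complex.ofReal_neg, ← sub_eq_add_neg] at h2
    rw [halfCoth, halfCoth, h2, hexp, ← Complex.ofReal_one, ← Complex.ofReal_ofNat]
    norm_cast
    rw [Real.exp_neg]
    have := Real.exp_pos a
    have n1 : -Real.exp a - 1 ≠ 0 := by linarith
    have n2 : -(Real.exp a)⁻¹ - 1 = (-Real.exp a - 1) / Real.exp a := by field_simp; ring
    rw [n2]
    field_simp
    ring
  have h3 := h.unique (h1.congr_fun fun n => ?_)
  · rw [h0] at h3
    rw [div_eq_iff hpi]
    push_cast at h3 ⊢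
    linear_combination h3
  · have := hpair ((n + 1) * (2 * K))
    push_cast at this
    rw [this, zero_add]

/-- The Weierstrass expression for `V` as a logarithmic derivative. -/
theorem complexV_eq (hη : 0 < η) (hK : η / 2 < K) :
    complexV η K = ((1 - K * logDerivU η K : ℝ) : ℂ) := by
  have hK0 : 0 < K := by linarith
  have hK2 : η < 2 * K := by linarith
  have hc := weierstrassZeta_pi_mul_I hK0
  have hu := hasSum_rowSq_real hK0
  have hz := hasSum_weierstrassZeta_rows hK0 (z := (η : ℂ)) fun n => by
    have e : (η : ℂ) - n * (2 * K) = ((η - n * (2 * K) : ℝ) : ℂ) := by push_cast; ring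
    rw [e, ← Complex.ofReal_exp]
    intro h1
    have h2 : Real.exp (η - n * (2 * K)) = 1 := by exact_mod_cast h1
    rw [Real.exp_eq_one_iff] at h2
    have h3 : (n : ℝ) * (2 * K) = η := by linarith
    have h4 : (0 : ℝ) < n := by
      by_contra hneg
      nlinarith
    have h5 : (1 : ℝ) ≤ n := by
      have : 0 < n := by exact_mod_cast h4
      exact_mod_cast this
    nlinarith
  have hz' := hz.unique ((hasSum_halfCoth_real hη hK2).add (hu.mul_left (2 * (η : ℂ))))
  have hp := (hasSum_weierstrassP_rows hK0 (η : ℂ)).unique (hasSum_rowSq_pair_real hη hK2)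
  rw [rowSq_ofReal hη] at hp
  rw [halfCoth_ofReal η hη] at hz'
  have hR := sq_tsum_v_mul_exp_sub_exp hK0 hη.ne' (by rwa [abs_of_pos hη])
  have hcoth : (Real.exp η + 1) / (Real.exp η - 1) = 2 / (1 - Real.exp (-η)) - 1 := by
    have h1 : 1 < Real.exp η := Real.one_lt_exp_iff.2 hη
    have h2 : Real.exp η - 1 ≠ 0 := by linarith
    have h4 : 1 - (Real.exp η)⁻¹ = (Real.exp η - 1) / Real.exp η := by field_simp
    rw [Real.exp_neg, h4]
    field_simp
    ring
  have he1 := exp_neg_lt_one hη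
  rw [hcoth] at hR
  rw [complexV, dif_pos hK0, hc]
  obtain ⟨S, hS⟩ : ∃ S, S = ∑' m : ℕ, v K m * (Real.exp (m * η) - Real.exp (-(m * η))) := ⟨_, rfl⟩
  obtain ⟨M, hM⟩ : ∃ M, M = ∑' m : ℕ, m * v K m := ⟨_, rfl⟩
  obtain ⟨W, hW⟩ : ∃ W, W = ∑' m : ℕ, m * (v K m * C η m) := ⟨_, rfl⟩
  obtain ⟨r, hr⟩ : ∃ r, r = Real.exp (-η) := ⟨_, rfl⟩
  rw [← hS, ← hM] at hz'
  rw [← hW, ← hr] at hp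
  rw [← hr] at hz' he1
  rw [← hS, ← hM, ← hW, ← hr] at hR
  rw [← hM]
  have hz'' : weierstrassZeta (rectPeriods K hK0) η =
      ((1 / (1 - r) - 1 / 2 - η / 12 - S + 2 * η * M : ℝ) : ℂ) := by
    push_cast at hz' ⊢
    linear_combination hz'
  have hp' : (rectPeriods K hK0).weierstrassP η = ((r / (1 - r) ^ 2 + 1 / 12 + W : ℝ) : ℂ) := by
    push_cast at hp ⊢
    linear_combination hp
  rw [hz'', hp']
  have hfin : 1 + K * ((1 / (1 - r) - 1 / 2 - η / 12 - S + 2 * η * M -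
      η * (-(1 / 12) + 2 * M)) ^ 2 - (r / (1 - r) ^ 2 + 1 / 12 + W) + 2 * (-(1 / 12) + 2 * M)) =
      1 - K * logDerivU η K := by
    have h1 : (1 / (1 - r) - 1 / 2) ^ 2 - r / (1 - r) ^ 2 = 1 / 4 := by
      have : 1 - r ≠ 0 := by linarith
      field_simp
      ring
    linear_combination K * hR + K * h1
  rw [← hfin]
  push_cast
  rfl

end

/-! ### Monotonicity and limits -/

section

variable {K η : ℝ}

theorem abs_lt_two_mul (hη : 0 < η) (hK : η / 2 < K) : |η| < 2 * K := by
  rw [abs_of_pos hη]; linarith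

theorem V_eq (hη : 0 < η) (hK : η / 2 < K) : V η K = 1 - K * logDerivU η K := by
  rw [V, complexV_eq hη hK, Complex.ofReal_re]

theorem U_pos (hη : 0 < η) (hK : η / 2 < K) : 0 < U η K := by
  rw [U_eq hη hK]
  exact mul_pos (by linarith [exp_neg_lt_one hη]) (Real.exp_pos _)

theorem U_half (hη : 0 < η) : U η (η / 2) = 0 := by
  rw [U_eq_reflected hη le_rfl, show 2 * (η / 2) - η = 0 by ring]
  simp

theorem hasDerivAt_U (hη : 0 < η) (hK : η / 2 < K) :
    HasDerivAt (U η) (U η K * logDerivU η K) K := by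
  have hK0 : 0 < K := by linarith
  have h := ((hasDerivAt_logT hK0 (abs_lt_two_mul hη hK)).neg.exp).const_mul (1 - Real.exp (-η))
  have heq : U η =ᶠ[𝓝 K] fun K => (1 - Real.exp (-η)) * Real.exp ((-logT η) K) := by
    filter_upwards [Ioi_mem_nhds hK] with y hy using U_eq hη hy
  refine (h.congr_of_eventuallyEq heq).congr_deriv ?_
  rw [U_eq hη hK, Pi.neg_apply]
  ring

/-- The derivative of `U V = U - K U'` is `-K U''`. -/
theorem hasDerivAt_UV (hη : 0 < η) (hK : η / 2 < K) :
    HasDerivAt (fun K => U η K * V η K)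
      (K * U η K * (secondSum η K - logDerivU η K ^ 2)) K := by
  have hK0 : 0 < K := by linarith
  have h : HasDerivAt (fun y => U η y * (1 - y * logDerivU η y)) _ K :=
    (hasDerivAt_U hη hK).mul (((hasDerivAt_id' K).mul
      (hasDerivAt_logDerivU hK0 (abs_lt_two_mul hη hK))).const_sub 1)
  have heq : (fun y => U η y * V η y) =ᶠ[𝓝 K] fun y => U η y * (1 - y * logDerivU η y) := by
    filter_upwards [Ioi_mem_nhds hK] with y hy
    rw [V_eq hη hy]
  refine (h.congr_of_eventuallyEq heq).congr_deriv ?_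
  ring

theorem strictMonoOn_Ioi_of_hasDerivAt_pos {f f' : ℝ → ℝ} {a : ℝ}
    (hf : ∀ x, a < x → HasDerivAt f (f' x) x) (hf' : ∀ x, a < x → 0 < f' x) :
    StrictMonoOn f (Ioi a) := by
  refine strictMonoOn_of_deriv_pos (convex_Ioi a)
    (fun x hx => (hf x hx).continuousAt.continuousWithinAt) fun x hx => ?_
  rw [interior_Ioi] at hx
  rw [(hf x hx).deriv]
  exact hf' x hx

theorem strictMonoOn_UV (hη : 0 < η) : StrictMonoOn (fun K => U η K * V η K) (Ioi (η / 2)) := by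
  refine strictMonoOn_Ioi_of_hasDerivAt_pos (fun K hK => hasDerivAt_UV hη hK) fun K hK => ?_
  have hK0 : 0 < K := by linarith
  exact mul_pos (mul_pos hK0 (U_pos hη hK))
    (sub_pos.2 (logDerivU_sq_lt hK0 hη.ne' (abs_lt_two_mul hη hK)))

theorem strictMonoOn_U (hη : 0 < η) : StrictMonoOn (U η) (Ici (η / 2)) := by
  have h : StrictMonoOn (U η) (Ioi (η / 2)) :=
    strictMonoOn_Ioi_of_hasDerivAt_pos (fun K hK => hasDerivAt_U hη hK) fun K hK =>
      mul_pos (U_pos hη hK) (logDerivU_pos (by linarith) hη.ne' (abs_lt_two_mul hη hK))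
  intro a ha b hb hab
  rcases eq_or_lt_of_le (mem_Ici.1 ha) with rfl | ha'
  · rw [U_half hη]
    exact U_pos hη hab
  · exact h ha' (ha'.trans hab) hab

theorem strictMonoOn_V (hη : 0 < η) : StrictMonoOn (V η) (Ioi (η / 2)) := by
  refine strictMonoOn_Ioi_of_hasDerivAt_pos
    (f' := fun K => K * secondSum η K - logDerivU η K) (fun K hK => ?_) fun K hK => ?_
  · have hK0 : 0 < K := by linarith
    have h : HasDerivAt (fun y => 1 - y * logDerivU η y) _ K :=
      ((hasDerivAt_id' K).mul (hasDerivAt_logDerivU hK0 (abs_lt_two_mul hη hK))).const_sub 1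
    have heq : V η =ᶠ[𝓝 K] fun y => 1 - y * logDerivU η y := by
      filter_upwards [Ioi_mem_nhds hK] with y hy using V_eq hη hy
    refine (h.congr_of_eventuallyEq heq).congr_deriv ?_
    ring
  · exact sub_pos.2 (logDerivU_lt (by linarith) hη.ne' (abs_lt_two_mul hη hK))

theorem tendsto_UV_atTop (hη : 0 < η) :
    Tendsto (fun K => U η K * V η K) atTop (𝓝 (1 - Real.exp (-η))) := by
  have h1 := ((Real.continuous_exp.tendsto _).comp (tendsto_logT_atTop η).neg).const_mul
    (1 - Real.exp (-η))
  have h := h1.mul ((tendsto_mul_logDerivU_atTop η).const_sub 1)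
  simp only [neg_zero, Real.exp_zero, mul_one, sub_zero] at h
  refine h.congr' ?_
  filter_upwards [eventually_gt_atTop (η / 2)] with K hK
  rw [U_eq hη hK, V_eq hη hK]
  rfl

theorem tendsto_UV_half (hη : 0 < η) :
    Tendsto (fun K => U η K * V η K) (𝓝[>] (η / 2)) (𝓝 (-η)) := by
  have hid : Tendsto (fun K : ℝ => K) (𝓝[>] (η / 2)) (𝓝 (η / 2)) :=
    tendsto_id.mono_left nhdsWithin_le_nhds
  have hd : Tendsto (fun K => 2 * K - η) (𝓝[>] (η / 2)) (𝓝 0) := by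
    have := (hid.const_mul 2).sub_const η
    rwa [show 2 * (η / 2) - η = 0 by ring] at this
  have hlog : Tendsto (fun K => logT (2 * K - η) K) (𝓝[>] (η / 2)) (𝓝 0) :=
    tendsto_logT_zero (K₀ := η / 2) (by linarith) hd
      (by filter_upwards [self_mem_nhdsWithin] with K hK using le_of_lt hK)
  have hexp := (Real.continuous_exp.tendsto _).comp hlog.neg
  have hd' : Tendsto (fun K => 2 * K - η) (𝓝[>] (η / 2)) (𝓝[≠] 0) := by
    refine tendsto_nhdsWithin_iff.2 ⟨hd, ?_⟩
    filter_upwards [self_mem_nhdsWithin] with K hK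
    have : η / 2 < K := hK
    simp only [mem_compl_iff, mem_singleton_iff]
    linarith
  -- for the factor of `U` that vanishes at `K = η / 2`
  have hslope : Tendsto (fun d : ℝ => (1 - Real.exp (-d)) / d) (𝓝[≠] 0) (𝓝 1) := by
    have h : HasDerivAt (fun d : ℝ => -Real.exp (-d)) 1 0 :=
      (((hasDerivAt_neg (0 : ℝ)).exp).neg).congr_deriv (by simp)
    refine (hasDerivAt_iff_tendsto_slope.1 h).congr fun d => ?_
    simp only [slope_def_field, neg_zero, Real.exp_zero, sub_zero]
    ring
  have hU : Tendsto (U η) (𝓝[>] (η / 2)) (𝓝 0) := by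
    have h := ((Real.continuous_exp.tendsto _).comp hd.neg).const_sub 1 |>.mul hexp
    simp only [neg_zero, Real.exp_zero, mul_one, sub_self] at h
    refine h.congr' ?_
    filter_upwards [self_mem_nhdsWithin] with K hK
    exact (U_eq_reflected hη (le_of_lt hK)).symm
  have hUL : Tendsto (fun K => U η K * logDerivU η K) (𝓝[>] (η / 2)) (𝓝 2) := by
    have h := ((hslope.comp hd').mul hexp).mul (tendsto_mul_logDerivU_half hη)
    simp only [neg_zero, Real.exp_zero, mul_one, one_mul] at h
    refine h.congr' ?_
    filter_upwards [self_mem_nhdsWithin] with K hK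
    have hne : 2 * K - η ≠ 0 := by have : η / 2 < K := hK; linarith
    rw [U_eq_reflected hη (le_of_lt hK)]
    simp only [Function.comp]
    field_simp
  have h := hU.sub (hid.mul hUL)
  rw [show 0 - η / 2 * 2 = -η by ring] at h
  refine h.congr' ?_
  filter_upwards [self_mem_nhdsWithin] with K hK
  rw [V_eq hη hK]
  ring

theorem U_sub_mul_deriv (hη : 0 < η) (hK : η / 2 < K) :
    U η K - K * deriv (U η) K = U η K * V η K := by
  rw [(hasDerivAt_U hη hK).deriv, V_eq hη hK]
  ring

theorem exists_UV_eq (hη : 0 < η) {y : ℝ} (h1 : -η < y) (h2 : y < 1 - Real.exp (-η)) :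
    ∃ K, η / 2 < K ∧ U η K * V η K = y := by
  have hcont : ContinuousOn (fun K => U η K * V η K) (Ioi (η / 2)) := fun K hK =>
    (hasDerivAt_UV hη hK).continuousAt.continuousWithinAt
  obtain ⟨a, ha, hay⟩ :=
    ((tendsto_UV_half hη).eventually_lt_const h1 |>.and self_mem_nhdsWithin).exists
  obtain ⟨b, hb, hyb⟩ :=
    ((tendsto_UV_atTop hη).eventually_const_lt h2 |>.and (eventually_gt_atTop (η / 2))).exists
  obtain ⟨K, hK, hKy⟩ := isPreconnected_Ioi.intermediate_value hay hyb hcont ⟨ha.le, hb.le⟩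
  exact ⟨K, hK, hKy⟩

end

end ImplicitHalfPeriod

end

theorem proposition3p9 (η : ℝ) (hη : 0 < η) :
    -- the formulas for `𝓤` and `𝓥` give real numbers
    (∀ K : ℝ, η / 2 < K →
      ImplicitHalfPeriod.complexU η K = (ImplicitHalfPeriod.U η K : ℂ) ∧
      ImplicitHalfPeriod.complexV η K = (ImplicitHalfPeriod.V η K : ℂ)) ∧
    -- `𝓤𝓥` is strictly increasing, with the stated limits
    StrictMonoOn (fun K : ℝ => ImplicitHalfPeriod.U η K * ImplicitHalfPeriod.V η K)
      (Ioi (η / 2)) ∧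
    Tendsto (fun K : ℝ => ImplicitHalfPeriod.U η K * ImplicitHalfPeriod.V η K)
      (𝓝[>] (η / 2)) (𝓝 (-η)) ∧
    Tendsto (fun K : ℝ => ImplicitHalfPeriod.U η K * ImplicitHalfPeriod.V η K)
      atTop (𝓝 (1 - Real.exp (-η))) ∧
    -- `𝓤` and `𝓥` are strictly increasing
    StrictMonoOn (ImplicitHalfPeriod.U η) (Ici (η / 2)) ∧
    StrictMonoOn (ImplicitHalfPeriod.V η) (Ioi (η / 2)) ∧
    -- `𝓤` is differentiable and `(1 - K ∂/∂K) 𝓤 = 𝓤𝓥`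
    (∀ K : ℝ, η / 2 < K →
      DifferentiableAt ℝ (ImplicitHalfPeriod.U η) K ∧
      ImplicitHalfPeriod.U η K - K * deriv (ImplicitHalfPeriod.U η) K =
        ImplicitHalfPeriod.U η K * ImplicitHalfPeriod.V η K) ∧
    -- the equation defining the implicit half-period has exactly one solution
    (∀ x : ℝ, ImplicitHalfPeriod.xStar η < x → x < 2 →
      ∃! K : ℝ, η / 2 < K ∧
        ImplicitHalfPeriod.U η K - K * deriv (ImplicitHalfPeriod.U η) K = -(η * x) / 2) := by
  open ImplicitHalfPeriod in
  refine ⟨fun K hK => ⟨complexU_eq_ofReal (by linarith), ?_⟩, strictMonoOn_UV hη,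
    tendsto_UV_half hη, tendsto_UV_atTop hη, strictMonoOn_U hη, strictMonoOn_V hη,
    fun K hK => ⟨(hasDerivAt_U hη hK).differentiableAt, U_sub_mul_deriv hη hK⟩,
    fun x hx1 hx2 => ?_⟩
  · rw [V, complexV_eq hη hK, Complex.ofReal_re]
  · have h1 : -η < -(η * x) / 2 := by nlinarith
    have h2 : -(η * x) / 2 < 1 - Real.exp (-η) := by
      rw [xStar, div_lt_iff₀ hη] at hx1
      linarith
    obtain ⟨K, hK, hKy⟩ := exists_UV_eq hη h1 h2
    refine ⟨K, ⟨hK, (U_sub_mul_deriv hη hK).trans hKy⟩, ?_⟩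
    rintro K' ⟨hK', hKy'⟩
    rw [U_sub_mul_deriv hη hK'] at hKy'
    exact (strictMonoOn_UV hη).injOn hK' hK (hKy'.trans hKy.symm)
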